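/- **Setting.** Let $\mathcal S,\mathcal A$ be finite, $T\ge 1$, $\gamma\in[0,1]$. Consider a Markov decision process with initial distribution $\mu$ and a transition law giving the joint distribution of $(R_t,S_{t+1})$ given $(S_t,A_t)$, and a continuously differentiable family of policies $\pi_\theta(a;s)>0$, $\theta\in\mathbb R^d$. For $t<T$ put $V_t^{\pi}(s)=\mathbb E^{\pi}[\sum_{i=t}^{T-1}\gamma^{i-t}R_i\mid S_t=s]$, $Q_t^{\pi}(s,a)=\mathbb E^{\pi}[\sum_{i=t}^{T-1}\gamma^{i-t}R_i\mid S_t=s,A_t=a]$, $\mathbb A_t^{\pi}=Q_t^{\pi}-V_t^{\pi}$, $J(\theta)=\sum_s\mu(s)V_0^{\pi_\theta}(s)$ and $J_*=\sup_\theta J(\theta)$. Norms are Euclidean. **Assumptions.** For all $\theta,\theta',s,a$ and all $t<T$: (i) $|R_t|\le R_*$ almost surely; (ii) $|\nabla_\theta\log\pi_\theta(a;s)|\le\Pi_*$; (iii) $|\nabla_\theta\log\pi_\theta(a;s)-\nabla_\theta\log\pi_{\theta'}(a;s)|\le L_s|\theta-\theta'|$; (iv) from a rollout of length $T$ under $\pi_\theta$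 (and possibly independent additional randomness) one computes advantage estimates $\hat{\mathbb A}_t$ with $|\hat{\mathbb A}_t|\le A_*$ almost surely and $\mathbb E^{\pi_\theta}\big[|\mathbb E^{\pi_\theta}[\hat{\mathbb A}_t\mid S_t,A_t]-\mathbb A_t^{\pi_\theta}(S_t,A_t)|^2\big]\le\delta^2$, where $\delta\ge0$. **Algorithm.** Let $n,B,m,K,C\ge1$ be integers with $N:=nT=mB$, let $\epsilon,\eta>0$, and let $\theta_{0,0,0}\in\mathbb R^d$ be deterministic. In each cycle $c=0,\dots,C-1$, given the past, sample $n$ independent rollouts of length $T$ under $\pi_{\theta_{c,0,0}}$ together with their advantage estimates, and flatten them into a buffer $(s^i,a^i,\hat{\mathbb A}^i,t^i)_{0\le i<N}$. In each epoch $e=0,\dots,K-1$ draw a fresh independent uniform permutation $\sigma$ of $\{0,\dots,N-1\}$, and for $k=0,\dots,m-1$ set $\mathcal B_k=\{\sigma_{kB},\dots,\sigma_{(k+1)B-1}\}$ and $$\theta_{c,e,k+1}=\theta_{c,e,k}+\frac{\eta}{B}\sum_{i\in\mathcal B_k}g^{(i)}(\theta_{c,e,k},\theta_{c,0,0}),\qquad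 g^{(i)}(\theta,\theta_{\rm old})=T\gamma^{t^i}\,\frac{\nabla_\theta\pi_\theta(a^i;s^i)}{\pi_{\theta_{\rm old}}(a^i;s^i)}\,\mathbf 1_{\left|\frac{\pi_\theta(a^i;s^i)}{\pi_{\theta_{\rm old}}(a^i;s^i)}-1\right|\le\epsilon}\,\hat{\mathbb A}^i .$$ Finally $\theta_{c,e+1,0}=\theta_{c,e,m}$ and $\theta_{c+1,0,0}=\theta_{c,K,0}$. **Theorem.** $J$ is differentiable and bounded above, and $\nabla J$ is Lipschitz continuous with constant $$R_*\sum_{t=0}^{T-1}\gamma^t\Big(L_s\sum_{k=0}^{T-t-1}\gamma^k+\Pi_*^2\gamma\sum_{k=0}^{T-t-2}\gamma^k\sum_{j=0}^{T-t-2-k}\gamma^j+(t+1)\Pi_*^2\sum_{k=0}^{T-t-1}\gamma^k\Big).$$ Let $L>0$ be any Lipschitz constant of $\nabla J$ and suppose $\eta<\frac1{Lm}$. Then for all $p,q\in(0,1)$ the variables $|\nabla J(\theta_{c,e,0})|^2$ are integrable and $$\begin{aligned}\min_{0\le c<C,\ 0\le e<K}\mathbb E\big[|\nabla J(\theta_{c,e,0})|^2\big]\le{}&\frac{2\Delta_0}{\eta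 CKm}+6\eta^2(7B_1^2+L^2)K^2m^2G^2\\&+42\,\eta^{2p}B_2^2\,\epsilon^{2(1-p)}|\mathcal A|^{2p}\Pi_*^{2p}K^{2p}m^{2p}G^{2p}\\&+\frac{42\,\eta^qB_3^2|\mathcal A|^q\Pi_*^qK^qm^qG^q}{\epsilon^q}+\frac{12\sigma^2}{N}+12T^2\Pi_*^2\delta^2,\end{aligned}$$ where $\Delta_0=J_*-J(\theta_{0,0,0})$, $B_1=TA_*L_s$, $B_2=B_3=TA_*\Pi_*$, $G=T(1+\epsilon)\Pi_*A_*$ and $\sigma^2=T\,\Pi_*^2A_*^2\big(\sum_{t=0}^{T-1}\gamma^t\big)^2$. -/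

import Mathlib

open MeasureTheory ProbabilityTheory

namespace PPO

noncomputable section

/-! ### Measurability helpers and two general kernel constructions -/

section Kernels

lemma measurable_finCons {Y : Type*} [MeasurableSpace Y] {k : ℕ} :
    Measurable fun z : Y × (Fin k → Y) => (Fin.cons z.1 z.2 : Fin (k + 1) → Y) := by
  refine measurable_pi_iff.2 fun i => ?_
  refine Fin.cases ?_ (fun j => ?_) i
  · exact measurable_fst
  · exact (measurable_pi_apply j).comp measurable_snd

/-- The law of `k` successive observations `y₀, …, y_{k-1}` of a controlled chain: starting from
the state `x`, draw `y₀ ∼ κ x`, move to the state `next (x, y₀)`, draw `y₁` there, and so on. -/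
def chain {X Y : Type*} [MeasurableSpace X] [MeasurableSpace Y] (κ : Kernel X Y)
    (next : X × Y → X) (hnext : Measurable next) : (k : ℕ) → Kernel X (Fin k → Y)
  | 0 => Kernel.const X (Measure.dirac Fin.elim0)
  | k + 1 => (κ ⊗ₖ (chain κ next hnext k).comap next hnext).map
      fun z => (Fin.cons z.1 z.2 : Fin (k + 1) → Y)

instance chain_isMarkovKernel {X Y : Type*} [MeasurableSpace X] [MeasurableSpace Y]
    (κ : Kernel X Y) [IsMarkovKernel κ] (next : X × Y → X) (hnext : Measurable next) (k : ℕ) :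
    IsMarkovKernel (chain κ next hnext k) := by
  induction k with
  | zero => unfold chain; infer_instance
  | succ k ih => unfold chain; exact Kernel.IsMarkovKernel.map _ measurable_finCons

/-- The law of `n` independent draws from `κ x`. -/
def iid {X Y : Type*} [MeasurableSpace X] [MeasurableSpace Y] (κ : Kernel X Y)
    [IsMarkovKernel κ] (n : ℕ) : Kernel X (Fin n → Y) where
  toFun x := Measure.pi fun _ => κ x
  measurable' := by
    refine Measurable.measure_of_isPiSystem_of_isProbabilityMeasure
      generateFrom_pi.symm isPiSystem_pi ?_
    rintro _ ⟨s, hs, rfl⟩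
    simp only [Measure.pi_pi]
    exact Finset.measurable_prod _ fun i _ => κ.measurable_coe (hs i (Set.mem_univ i))

instance iid_isMarkovKernel {X Y : Type*} [MeasurableSpace X] [MeasurableSpace Y]
    (κ : Kernel X Y) [IsMarkovKernel κ] (n : ℕ) : IsMarkovKernel (iid κ n) :=
  ⟨fun x => by change IsProbabilityMeasure (Measure.pi fun _ => κ x); infer_instance⟩

instance permMeasurableSpace (N : ℕ) : MeasurableSpace (Equiv.Perm (Fin N)) := ⊤

instance permDiscrete (N : ℕ) : DiscreteMeasurableSpace (Equiv.Perm (Fin N)) :=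
  ⟨fun _ => trivial⟩

/-- `K` independent uniformly distributed permutations of `{0, …, N-1}`. -/
def shuffleLaw (K N : ℕ) : Measure (Fin K → Equiv.Perm (Fin N)) :=
  Measure.pi fun _ => (PMF.uniformOfFintype (Equiv.Perm (Fin N))).toMeasure

instance shuffleLaw_prob (K N : ℕ) : IsProbabilityMeasure (shuffleLaw K N) := by
  unfold shuffleLaw; infer_instance

end Kernels

/-! ### Markov decision process and parametrized policy -/

/-- Policy parameters: `ℝ^d` with the Euclidean norm. -/
abbrev Param (d : ℕ) : Type := EuclideanSpace ℝ (Fin d)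

/-- A Markov decision process: initial distribution, and the joint law of the reward `R_t` and the
next state `S_{t+1}` given `(S_t, A_t)`. -/
structure MDP (S A : Type*) [MeasurableSpace S] [MeasurableSpace A] where
  init : Measure S
  init_prob : IsProbabilityMeasure init
  step : Kernel (S × A) (ℝ × S)
  step_markov : IsMarkovKernel step

attribute [instance] MDP.init_prob MDP.step_markov

/-- A continuously differentiable family of policies with full support; `prob θ s a = π_θ(a; s)`. -/
structure PolicyFamily (d : ℕ) (S A : Type*) [Fintype A] where
  prob : Param d → S → A → ℝ
  prob_pos : ∀ θ s a, 0 < prob θ s a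
  prob_sum : ∀ θ s, ∑ a, prob θ s a = 1
  contDiff : ∀ s a, ContDiff ℝ 1 fun θ => prob θ s a

/-- A transition `(S_t, A_t, R_t, S_{t+1})`. -/
abbrev Transition (S A : Type*) : Type _ := S × A × ℝ × S

namespace PolicyFamily

variable {d : ℕ} {S A : Type*} [Fintype A] (π : PolicyFamily d S A)

/-- The score function `∇_θ log π_θ(a; s)`. -/
def score (θ : Param d) (s : S) (a : A) : Param d :=
  gradient (fun ϑ => Real.log (π.prob ϑ s a)) θ

variable [Fintype S] [MeasurableSpace S] [MeasurableSingletonClass S]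
  [MeasurableSpace A] [MeasurableSingletonClass A]

/-- The action distribution `π_θ(· ; s)` as a kernel in `(θ, s)`. -/
def actionKernel : Kernel (Param d × S) A where
  toFun x := ∑ a, ENNReal.ofReal (π.prob x.1 x.2 a) • Measure.dirac a
  measurable' := by
    refine Measure.measurable_of_measurable_coe _ fun s _ => ?_
    simp only [Measure.finsetSum_apply, Measure.smul_apply, smul_eq_mul]
    refine Finset.measurable_sum _ fun a _ => Measurable.mul_const ?_ _
    refine ENNReal.measurable_ofReal.comp ?_
    exact measurable_from_prod_countable_left fun s => (π.contDiff s a).continuous.measurable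

instance actionKernel_markov : IsMarkovKernel π.actionKernel := by
  refine ⟨fun x => ⟨?_⟩⟩
  change (∑ a, ENNReal.ofReal (π.prob x.1 x.2 a) • Measure.dirac a : Measure A) Set.univ = 1
  simp only [Measure.finsetSum_apply, Measure.smul_apply, smul_eq_mul, measure_univ, mul_one]
  rw [← ENNReal.ofReal_sum_of_nonneg fun a _ => (π.prob_pos _ _ _).le, π.prob_sum]
  simp

end PolicyFamily

section Model

variable {d : ℕ} {S A : Type*} [Fintype S] [MeasurableSpace S] [MeasurableSingletonClass S]
  [Fintype A] [MeasurableSpace A] [MeasurableSingletonClass A]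
  (P : MDP S A) (π : PolicyFamily d S A)

/-- One transition under `π_θ` from the state `s`. -/
def transitionKernel : Kernel (Param d × S) (Transition S A) :=
  Kernel.deterministic Prod.snd measurable_snd ×ₖ
    (π.actionKernel ⊗ₖ P.step.comap (fun z : (Param d × S) × A => (z.1.2, z.2)) (by fun_prop))

instance transitionKernel_markov : IsMarkovKernel (transitionKernel P π) := by
  unfold transitionKernel; infer_instance

/-- `k` consecutive transitions under `π_θ` from the state `s`. -/
def rolloutFrom (k : ℕ) : Kernel (Param d × S) (Fin k → Transition S A) :=
  chain (transitionKernel P π)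
    (fun z : (Param d × S) × Transition S A => (z.1.1, z.2.2.2.2)) (by fun_prop) k

instance rolloutFrom_markov (k : ℕ) : IsMarkovKernel (rolloutFrom P π k) := by
  unfold rolloutFrom; infer_instance

/-- The first reward and next state after playing `a` in `s`, followed by `k` transitions
under `π_θ`. -/
def rolloutFromAction (k : ℕ) :
    Kernel (Param d × S × A) ((ℝ × S) × (Fin k → Transition S A)) :=
  P.step.comap Prod.snd measurable_snd ⊗ₖ
    (rolloutFrom P π k).comap
      (fun z : (Param d × S × A) × (ℝ × S) => (z.1.1, z.2.2)) (by fun_prop)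

/-- The law of a rollout of length `T` under `π_θ` with initial distribution `μ`. -/
def rolloutLaw (T : ℕ) : Kernel (Param d) (Fin T → Transition S A) :=
  rolloutFrom P π T ∘ₖ (Kernel.id ×ₖ Kernel.const (Param d) P.init)

instance rolloutLaw_markov (T : ℕ) : IsMarkovKernel (rolloutLaw P π T) := by
  unfold rolloutLaw; infer_instance

/-- Discounted sum of the rewards of a sequence of transitions. -/
def discountedReturn (γ : ℝ) {k : ℕ} (τ : Fin k → Transition S A) : ℝ :=
  ∑ i : Fin k, γ ^ (i : ℕ) * (τ i).2.2.1

/-- `V_t^{π_θ}(s)` for the horizon `T`. -/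
def value (T : ℕ) (γ : ℝ) (θ : Param d) (t : ℕ) (s : S) : ℝ :=
  ∫ τ, discountedReturn γ τ ∂(rolloutFrom P π (T - t) (θ, s))

/-- `Q_t^{π_θ}(s, a)` for the horizon `T` and `t ≤ T - 1`. -/
def qValue (T : ℕ) (γ : ℝ) (θ : Param d) (t : ℕ) (s : S) (a : A) : ℝ :=
  ∫ x, (x.1.1 + γ * discountedReturn γ x.2) ∂(rolloutFromAction P π (T - t - 1) (θ, s, a))

/-- The advantage function `Q_t - V_t`. -/
def advantage (T : ℕ) (γ : ℝ) (θ : Param d) (t : ℕ) (s : S) (a : A) : ℝ :=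
  qValue P π T γ θ t s a - value P π T γ θ t s

/-- The objective `J(θ) = ∑ s, μ(s) V_0^{π_θ}(s)`. -/
def objective (T : ℕ) (γ : ℝ) (θ : Param d) : ℝ :=
  ∑ s, P.init.real {s} * value P π T γ θ 0 s

/-! ### Sampling: rollouts with advantage estimates, transition buffer -/

/-- A rollout of length `T` together with the advantage estimates for its `T` transitions. -/
abbrev Sample (S A : Type*) (T : ℕ) : Type _ := (Fin T → Transition S A) × (Fin T → ℝ)

/-- An advantage estimator: given the sampling parameter and a rollout it returns (possibly with
additional randomness) the estimates for the transitions of that rollout. -/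
abbrev Estimator (d : ℕ) (S A : Type*) [MeasurableSpace S] [MeasurableSpace A] (T : ℕ) : Type _ :=
  Kernel (Param d × (Fin T → Transition S A)) (Fin T → ℝ)

/-- The law of a rollout under `π_θ` with its advantage estimates. -/
def sampleLaw {T : ℕ} (est : Estimator d S A T) : Kernel (Param d) (Sample S A T) :=
  rolloutLaw P π T ⊗ₖ est

instance sampleLaw_markov {T : ℕ} (est : Estimator d S A T) [IsMarkovKernel est] :
    IsMarkovKernel (sampleLaw P π est) := by
  unfold sampleLaw; infer_instance

/-- The σ-algebra generated by `(S_t, A_t)`. -/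
@[reducible] def stateActionSigma (S A : Type*) [MeasurableSpace S] [MeasurableSpace A] {T : ℕ} (t : Fin T) :
    MeasurableSpace (Sample S A T) :=
  MeasurableSpace.comap (fun ω => ((ω.1 t).1, (ω.1 t).2.1)) inferInstance

/-- The mean squared bias `E^{π_θ}[ |E^{π_θ}[Â_t | S_t, A_t] - 𝔸_t^{π_θ}(S_t, A_t)|² ]`. -/
def estimatorBias {T : ℕ} (γ : ℝ) (est : Estimator d S A T) (θ : Param d) (t : Fin T) : ℝ :=
  ∫ ω, (((sampleLaw P π est θ)[fun ω' => ω'.2 t | stateActionSigma S A t]) ω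
      - advantage P π T γ θ t (ω.1 t).1 (ω.1 t).2.1) ^ 2 ∂(sampleLaw P π est θ)

/-- The randomness used in one cycle: `n` rollouts with advantage estimates, and `K` permutations
of the indices of the buffer of size `n * T`. -/
abbrev CycleData (S A : Type*) (n T K : ℕ) : Type _ :=
  (Fin n → Sample S A T) × (Fin K → Equiv.Perm (Fin (n * T)))

/-- The law of the randomness of a cycle with sampling parameter `θ_old`. -/
def cycleLaw {T : ℕ} (n K : ℕ) (est : Estimator d S A T) [IsMarkovKernel est] :
    Kernel (Param d) (CycleData S A n T K) :=
  iid (sampleLaw P π est) n ×ₖ Kernel.const (Param d) (shuffleLaw K (n * T))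

instance cycleLaw_markov {T : ℕ} (n K : ℕ) (est : Estimator d S A T) [IsMarkovKernel est] :
    IsMarkovKernel (cycleLaw P π n K est) := by
  unfold cycleLaw; infer_instance

end Model

/-! ### The update scheme -/

section Algorithm

variable {d : ℕ} {S A : Type*} [Fintype A] (π : PolicyFamily d S A)

/-- The clipped surrogate contribution of a transition at time `t` with state `s`, action `a` and
advantage estimate `adv`. -/
def clippedContribution (T : ℕ) (γ ε : ℝ) (θ θold : Param d) (t : ℕ) (s : S) (a : A) (adv : ℝ) :
    Param d :=
  (T * γ ^ t * (if |π.prob θ s a / π.prob θold s a - 1| ≤ ε then 1 else 0) * adv) •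
    ((π.prob θold s a)⁻¹ • gradient (fun ϑ => π.prob ϑ s a) θ)

/-- The contribution of the entry `i` of the transition buffer, into which the `n` rollouts of
length `T` are flattened. -/
def bufferContribution {n T : ℕ} (γ ε : ℝ) (data : Fin n → Sample S A T) (θ θold : Param d)
    (i : Fin (n * T)) : Param d :=
  let j : Fin n := (finProdFinEquiv.symm i).1
  let t : Fin T := (finProdFinEquiv.symm i).2
  clippedContribution π T γ ε θ θold t ((data j).1 t).1 ((data j).1 t).2.1 ((data j).2 t)

/-- The minibatch `{σ_{kB}, …, σ_{(k+1)B-1}}`. -/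
def minibatch {N : ℕ} (B : ℕ) (σ : Equiv.Perm (Fin N)) (k : ℕ) : Finset (Fin N) :=
  (Finset.univ.filter fun j : Fin N => k * B ≤ (j : ℕ) ∧ (j : ℕ) < (k + 1) * B).image σ

/-- The minibatch surrogate gradient. -/
def minibatchGradient {n T : ℕ} (γ ε : ℝ) (B : ℕ) (data : Fin n → Sample S A T)
    (θ θold : Param d) (I : Finset (Fin (n * T))) : Param d :=
  (B : ℝ)⁻¹ • ∑ i ∈ I, bufferContribution π γ ε data θ θold i

/-- The parameter after `k` minibatch updates of an epoch that starts at `θ`. -/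
def epochParam {n T : ℕ} (γ ε η : ℝ) (B : ℕ) (data : Fin n → Sample S A T) (θold : Param d)
    (σ : Equiv.Perm (Fin (n * T))) (θ : Param d) : ℕ → Param d
  | 0 => θ
  | k + 1 =>
    epochParam γ ε η B data θold σ θ k +
      η • minibatchGradient π γ ε B data (epochParam γ ε η B data θold σ θ k) θold
        (minibatch B σ k)

/-- The parameter after `e` epochs (of `m` updates each) of a cycle that starts at `θold`. -/
def cycleParam {n T K : ℕ} (γ ε η : ℝ) (B m : ℕ) (D : CycleData S A n T K) (θold : Param d) :
    Fin (K + 1) → Param d :=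
  Fin.induction θold fun e θ => epochParam π γ ε η B D.1 θold (D.2 e) θ m

/-- The initial parameter `θ_{c,0,0}` of cycle `c`, where `ω` is the randomness of all cycles. -/
def runParam {n T K C : ℕ} (γ ε η : ℝ) (B m : ℕ) (θ₀ : Param d) (ω : Fin C → CycleData S A n T K) :
    Fin (C + 1) → Param d :=
  Fin.induction θ₀ fun c θ => cycleParam π γ ε η B m (ω c) θ (Fin.last K)

/-- The iterate `θ_{c,e,k}`. -/
def iterate {n T K C : ℕ} (γ ε η : ℝ) (B m : ℕ) (θ₀ : Param d) (ω : Fin C → CycleData S A n T K)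
    (c : Fin C) (e : Fin K) (k : ℕ) : Param d :=
  let θold := runParam π γ ε η B m θ₀ ω c.castSucc
  epochParam π γ ε η B (ω c).1 θold ((ω c).2 e)
    (cycleParam π γ ε η B m (ω c) θold e.castSucc) k

variable [Fintype S] [MeasurableSpace S] [MeasurableSingletonClass S]
  [MeasurableSpace A] [MeasurableSingletonClass A]

lemma measurable_clippedContribution (T : ℕ) (γ ε : ℝ) (t : ℕ) :
    Measurable fun z : (Param d × Param d × ℝ) × (S × A) =>
      clippedContribution π T γ ε z.1.1 z.1.2.1 t z.2.1 z.2.2 z.1.2.2 := by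
  refine measurable_from_prod_countable_left fun sa => ?_
  obtain ⟨s, a⟩ := sa
  have hp : Measurable fun θ => π.prob θ s a := (π.contDiff s a).continuous.measurable
  have hg : Measurable fun θ => gradient (fun ϑ => π.prob ϑ s a) θ := by
    have h := (π.contDiff s a).continuous_fderiv (by norm_num)
    exact ((InnerProductSpace.toDual ℝ (Param d)).symm.continuous.comp h).measurable
  have h1 : Measurable fun z : Param d × Param d × ℝ => π.prob z.1 s a := hp.comp measurable_fst
  have h2 : Measurable fun z : Param d × Param d × ℝ => π.prob z.2.1 s a :=
    hp.comp (measurable_fst.comp measurable_snd)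
  have h3 : Measurable fun z : Param d × Param d × ℝ => gradient (fun ϑ => π.prob ϑ s a) z.1 :=
    hg.comp measurable_fst
  unfold clippedContribution
  have h4 : Measurable fun z : Param d × Param d × ℝ => z.2.2 :=
    measurable_snd.comp measurable_snd
  refine Measurable.smul (Measurable.mul (Measurable.const_mul ?_ _) h4) (h2.inv.smul h3)
  refine Measurable.ite ?_ measurable_const measurable_const
  exact measurableSet_le (((h1.div h2).sub_const 1).abs) measurable_const

lemma measurable_bufferContribution {n T : ℕ} (γ ε : ℝ) (i : Fin (n * T)) :
    Measurable fun z : Param d × Param d × (Fin n → Sample S A T) =>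
      bufferContribution π γ ε z.2.2 z.1 z.2.1 i := by
  obtain ⟨j, hj⟩ : ∃ j : Fin n, j = (finProdFinEquiv.symm i).1 := ⟨_, rfl⟩
  obtain ⟨t, ht⟩ : ∃ t : Fin T, t = (finProdFinEquiv.symm i).2 := ⟨_, rfl⟩
  have h : Measurable fun z : Param d × Param d × (Fin n → Sample S A T) =>
      (((z.1, z.2.1, (z.2.2 j).2 t), (((z.2.2 j).1 t).1, ((z.2.2 j).1 t).2.1)) :
        (Param d × Param d × ℝ) × (S × A)) := by fun_prop
  have h' := (measurable_clippedContribution π T γ ε (t : ℕ)).comp h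
  simpa only [bufferContribution, ← hj, ← ht, Function.comp_def] using h'

lemma measurable_epochParam {n T : ℕ} (γ ε η : ℝ) (B : ℕ) (σ : Equiv.Perm (Fin (n * T))) (k : ℕ) :
    Measurable fun z : Param d × Param d × (Fin n → Sample S A T) =>
      epochParam π γ ε η B z.2.2 z.2.1 σ z.1 k := by
  induction k with
  | zero => exact measurable_fst
  | succ k ih =>
    have h1 : ∀ i : Fin (n * T), Measurable fun z : Param d × Param d × (Fin n → Sample S A T) =>
        bufferContribution π γ ε z.2.2 (epochParam π γ ε η B z.2.2 z.2.1 σ z.1 k) z.2.1 i :=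
      fun i => by
        have h := (measurable_bufferContribution (n := n) (T := T) π γ ε i).comp
          (ih.prodMk measurable_snd)
        simpa only [Function.comp_def] using h
    have h2 := Finset.measurable_fun_sum (minibatch B σ k) fun i _ => h1 i
    exact ih.add ((h2.const_smul ((B : ℝ)⁻¹)).const_smul η)

lemma measurable_cycleParam {n T K : ℕ} (γ ε η : ℝ) (B m : ℕ) (e : Fin (K + 1)) :
    Measurable fun z : Param d × CycleData S A n T K =>
      cycleParam π γ ε η B m z.2 z.1 e := by
  have key : ∀ σs : Fin K → Equiv.Perm (Fin (n * T)),
      Measurable fun z : Param d × (Fin n → Sample S A T) =>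
        cycleParam π γ ε η B m ((z.2, σs) : CycleData S A n T K) z.1 e := by
    intro σs
    induction e using Fin.induction with
    | zero => exact measurable_fst
    | succ e ih =>
      have h := (measurable_epochParam (S := S) π γ ε η B (σs e) m).comp (ih.prodMk measurable_id)
      simpa [cycleParam, Function.comp_def] using h
  have h' : Measurable fun z : (Param d × (Fin n → Sample S A T)) ×
      (Fin K → Equiv.Perm (Fin (n * T))) =>
        cycleParam π γ ε η B m ((z.1.2, z.2) : CycleData S A n T K) z.1.1 e :=
    measurable_from_prod_countable_left key
  exact h'.comp (by fun_prop : Measurable fun z : Param d × CycleData S A n T K =>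
    ((z.1, z.2.1), z.2.2))

/-- The law of the randomness of `C` cycles started at the parameter `θ₀`: in each cycle the data
are drawn afresh under the policy given by the current parameter. -/
def runLaw (P : MDP S A) {T : ℕ} (n K C : ℕ) (γ ε η : ℝ) (B m : ℕ) (est : Estimator d S A T)
    [IsMarkovKernel est] (θ₀ : Param d) : Measure (Fin C → CycleData S A n T K) :=
  chain (cycleLaw P π n K est)
    (fun z : Param d × CycleData S A n T K => cycleParam π γ ε η B m z.2 z.1 (Fin.last K))
    (measurable_cycleParam π γ ε η B m (Fin.last K)) C θ₀

end Algorithm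

/-- The explicit Lipschitz constant of `∇J`. -/
def smoothnessConst (T : ℕ) (γ Rstar Pistar Ls : ℝ) : ℝ :=
  Rstar * ∑ t ∈ Finset.range T, γ ^ t *
    (Ls * ∑ k ∈ Finset.range (T - t), γ ^ k
      + Pistar ^ 2 * γ * ∑ k ∈ Finset.range (T - t - 1),
          γ ^ k * ∑ j ∈ Finset.range (T - t - 1 - k), γ ^ j
      + (t + 1) * Pistar ^ 2 * ∑ k ∈ Finset.range (T - t), γ ^ k)

end

end PPO

/-!
The proof combines the smoothness of the objective `J` with a pathwise analysis of a cycle.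

*Smoothness of `J`.* Integrating out the reward and the transition kernel turns value functions into
the solution of a finite backward recursion (`value_eq_valueToGo`, `qValue_eq_qToGo`). Induction on
the number of steps to go gives the policy gradient theorem (`hasGradientAt_valueToGo`). The policy
gradient is Lipschitz because the score, the state-action values and the law of `(S_t, A_t)` are;
the three contributions add up to the smoothness constant (`norm_policyGradient_sub_le`).

*Progress of a cycle.* An epoch moves the parameter by `η m` times the average of the clipped
contributions over the whole buffer, since the minibatches partition it. As `L η m ≤ 1`, the ascent
inequality (`norm_gradient_sq_le_of_ascent`) bounds `‖∇J(θ_e)‖²` by the increase of `J` and the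
squared error of that average as an approximation of `∇J(θ_e)`. The error has three parts:
the drift of `∇J` within the cycle; the error of the policy gradient estimate at the sampling
parameter `θ_old`, treated by a bias-variance decomposition over the `n` independent rollouts
(`integral_norm_sq_average_sub_le`, `norm_integral_rolloutGradient_sub_le`); and the change of the
clipped contributions between `θ_old` and the current parameter. All parameters of a cycle lie
within `ρ = η K m G` of `θ_old`. Only the second part needs an expectation, the others are bounded
along almost every path, so the dependence of the iterates on the buffer and the shuffles is harmless.

*Clipping.* Put `w = Pistar ρ`. The logarithm of the policy is `Pistar`-Lipschitz in the parameter,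
so for `w ≤ 1` every likelihood ratio within the cycle differs from `1` by at most `2 w`, which
gives both clipping terms (`sq_one_sub_clipped_ratio_le`). For `w ≥ 1` one of the two clipping terms
of the bound is at least `42 B₂²`, and the estimate is implied by
`‖∇J‖ ≤ T Pistar (Astar + δ)` (`norm_gradient_objective_le`), a consequence of the policy gradient
theorem and the two assumptions on the advantage estimates.

Finally, a drift argument for the chain of cycles (`integral_chain_sum_le`) telescopes the increases
of `J`, and the smallest of the expected squared norms is at most their average.
-/

set_option linter.unusedSectionVars false

namespace PPO

/-! ### Scores and policy ratios -/

section Policy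

variable {d : ℕ} {S A : Type*} [Fintype A] (π : PolicyFamily d S A)

lemma hasGradientAt_log_prob (θ : Param d) (s : S) (a : A) :
    HasGradientAt (fun ϑ => Real.log (π.prob ϑ s a)) (π.score θ s a) θ :=
  (((π.contDiff s a).differentiable (by norm_num) θ).log (π.prob_pos θ s a).ne').hasGradientAt

lemma hasFDerivAt_prob (θ : Param d) (s : S) (a : A) :
    HasFDerivAt (fun ϑ => π.prob ϑ s a)
      (π.prob θ s a • InnerProductSpace.toDual ℝ (Param d) (π.score θ s a)) θ := by
  have h := (hasGradientAt_log_prob π θ s a).hasFDerivAt.exp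
  simpa only [Real.exp_log (π.prob_pos _ s a)] using h

lemma hasGradientAt_prob (θ : Param d) (s : S) (a : A) :
    HasGradientAt (fun ϑ => π.prob ϑ s a) (π.prob θ s a • π.score θ s a) θ := by
  rw [hasGradientAt_iff_hasFDerivAt, map_smul]
  exact hasFDerivAt_prob π θ s a

/-- The score is centred under the policy. -/
lemma sum_prob_smul_score (θ : Param d) (s : S) :
    ∑ a, π.prob θ s a • π.score θ s a = 0 := by
  have h := HasFDerivAt.fun_sum (u := Finset.univ) fun a _ => hasFDerivAt_prob π θ s a
  simp only [π.prob_sum] at h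
  have h0 := h.unique (hasFDerivAt_const (1 : ℝ) θ)
  apply (InnerProductSpace.toDual ℝ (Param d)).injective
  simpa using h0

/-- The policies at two parameters differ in total variation norm by at most `Pistar ‖θ - θ'‖`:
along a direction `v` the derivative of `∑ a, ± π_θ(a; s)` is a policy average of the numbers
`± ⟪score, v⟫`. -/
lemma sum_abs_prob_sub_le {Pistar : ℝ} (hscore : ∀ θ s a, ‖π.score θ s a‖ ≤ Pistar)
    (θ θ' : Param d) (s : S) :
    ∑ a, |π.prob θ s a - π.prob θ' s a| ≤ Pistar * ‖θ - θ'‖ := by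
  set sg : A → ℝ := fun a => SignType.sign (π.prob θ s a - π.prob θ' s a) with hsg
  have hsg1 : ∀ a, |sg a| ≤ 1 := fun a => by
    simp only [hsg]
    rcases SignType.trichotomy (SignType.sign (π.prob θ s a - π.prob θ' s a)) with h | h | h <;>
      simp [h]
  have hd : ∀ ϑ ∈ (Set.univ : Set (Param d)),
      HasFDerivWithinAt (fun ϑ => ∑ a, sg a * π.prob ϑ s a)
      (∑ a, sg a • (π.prob ϑ s a • InnerProductSpace.toDual ℝ (Param d) (π.score ϑ s a)))
      Set.univ ϑ := fun ϑ _ =>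
    (HasFDerivAt.fun_sum fun a _ => (hasFDerivAt_prob π ϑ s a).const_mul (sg a)).hasFDerivWithinAt
  have hb : ∀ ϑ ∈ (Set.univ : Set (Param d)),
      ‖∑ a, sg a • (π.prob ϑ s a • InnerProductSpace.toDual ℝ (Param d) (π.score ϑ s a))‖
        ≤ Pistar := by
    intro ϑ _
    calc _ ≤ ∑ a, π.prob ϑ s a * Pistar := by
          refine norm_sum_le_of_le _ fun a _ => ?_
          rw [norm_smul, norm_smul, LinearIsometryEquiv.norm_map, Real.norm_eq_abs,
            Real.norm_of_nonneg (π.prob_pos ϑ s a).le]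
          have h1 := mul_le_mul_of_nonneg_left (hscore ϑ s a) (π.prob_pos ϑ s a).le
          have h2 := mul_nonneg (π.prob_pos ϑ s a).le (norm_nonneg (π.score ϑ s a))
          nlinarith [hsg1 a]
      _ = Pistar := by rw [← Finset.sum_mul, π.prob_sum, one_mul]
  have h := convex_univ.norm_image_sub_le_of_norm_hasFDerivWithin_le hd hb
    (Set.mem_univ θ') (Set.mem_univ θ)
  refine le_trans (le_of_eq ?_) ((le_abs_self _).trans h)
  rw [← Finset.sum_sub_distrib]
  refine Finset.sum_congr rfl fun a _ => ?_
  rw [← mul_sub]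
  exact (sign_mul_self _).symm

lemma norm_sum_prob_sub_smul_le {Pistar : ℝ} (hscore : ∀ θ s a, ‖π.score θ s a‖ ≤ Pistar)
    {F : Type*} [NormedAddCommGroup F] [NormedSpace ℝ F]
    (θ θ' : Param d) (s : S) {f : A → F} {M : ℝ} (hf : ∀ a, ‖f a‖ ≤ M) (hM : 0 ≤ M) :
    ‖∑ a, (π.prob θ s a - π.prob θ' s a) • f a‖ ≤ Pistar * ‖θ - θ'‖ * M := by
  calc _ ≤ ∑ a, |π.prob θ s a - π.prob θ' s a| * M := norm_sum_le_of_le _ fun a _ => by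
          rw [norm_smul, Real.norm_eq_abs]
          exact mul_le_mul_of_nonneg_left (hf a) (abs_nonneg _)
    _ ≤ _ := by
          rw [← Finset.sum_mul]
          exact mul_le_mul_of_nonneg_right (sum_abs_prob_sub_le π hscore θ θ' s) hM

lemma abs_log_prob_sub_le {Pistar : ℝ} (hscore : ∀ θ s a, ‖π.score θ s a‖ ≤ Pistar)
    (θ θ' : Param d) (s : S) (a : A) :
    |Real.log (π.prob θ s a) - Real.log (π.prob θ' s a)| ≤ Pistar * ‖θ - θ'‖ := by
  refine convex_univ.norm_image_sub_le_of_norm_hasFDerivWithin_le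
    (fun ϑ _ => (hasGradientAt_log_prob π ϑ s a).hasFDerivAt.hasFDerivWithinAt) (fun ϑ _ => ?_)
    (Set.mem_univ θ') (Set.mem_univ θ)
  rw [LinearIsometryEquiv.norm_map]
  exact hscore ϑ s a

/-- Since `log π_θ` is `Pistar`-Lipschitz, the likelihood ratio is close to `1` near the reference
parameter, uniformly in the state and the action. -/
lemma abs_prob_div_sub_one_le {Pistar : ℝ} (hscore : ∀ θ s a, ‖π.score θ s a‖ ≤ Pistar)
    {w : ℝ} (hw : w ≤ 1) (θ θ' : Param d) (s : S) (a : A)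
    (h : Pistar * ‖θ - θ'‖ ≤ w) : |π.prob θ s a / π.prob θ' s a - 1| ≤ 2 * w := by
  have h1 := (abs_log_prob_sub_le π hscore θ θ' s a).trans h
  rw [← Real.log_div (π.prob_pos _ _ _).ne' (π.prob_pos _ _ _).ne'] at h1
  have h2 := Real.abs_exp_sub_one_le (h1.trans hw)
  rw [Real.exp_log (div_pos (π.prob_pos _ _ _) (π.prob_pos _ _ _))] at h2
  linarith

end Policy

/-! ### Dynamic programming and the policy gradient -/

section FiniteModel

variable {d : ℕ} {S A : Type*} [Fintype S] [MeasurableSpace S]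
  [Fintype A] [MeasurableSpace A] (P : MDP S A) (π : PolicyFamily d S A)
  {F : Type*} [NormedAddCommGroup F] [NormedSpace ℝ F]

/-- The expected reward of the action `a` in the state `s`. -/
noncomputable def meanReward (s : S) (a : A) : ℝ := ∫ x, x.1 ∂(P.step (s, a))

/-- The probability of moving from `s` to `s'` under the action `a`. -/
noncomputable def transProb (s : S) (a : A) (s' : S) : ℝ :=
  (P.step (s, a)).real (Prod.snd ⁻¹' {s'})

lemma transProb_nonneg (s : S) (a : A) (s' : S) : 0 ≤ transProb P s a s' := measureReal_nonneg

lemma sum_transProb [MeasurableSingletonClass S] (s : S) (a : A) :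
    ∑ s', transProb P s a s' = 1 := by
  have h : ∀ s', transProb P s a s' = ((P.step (s, a)).map Prod.snd).real {s'} := fun s' => by
    rw [map_measureReal_apply measurable_snd (measurableSet_singleton s')]; rfl
  have := Measure.isProbabilityMeasure_map (μ := P.step (s, a)) measurable_snd.aemeasurable
  simp only [h, sum_measureReal_singleton, Finset.coe_univ, probReal_univ]

/-- The one-step transition operator of the policy `π_θ`:
`g ↦ E^{π_θ}[g(S_{t+1}) | S_t = ·]`. -/
noncomputable def stepMean (θ : Param d) (g : S → F) (s : S) : F :=
  ∑ a, π.prob θ s a • ∑ s', transProb P s a s' • g s'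

/-- `E^{π_θ}[f(S_t, A_t) | S_0 = s]`. -/
noncomputable def visitMean (θ : Param d) (f : S → A → F) : ℕ → S → F
  | 0 => fun s => ∑ a, π.prob θ s a • f s a
  | t + 1 => stepMean P π θ (visitMean θ f t)

/-- The value function with `k` steps to go, by dynamic programming. -/
noncomputable def valueToGo (γ : ℝ) (θ : Param d) : ℕ → S → ℝ
  | 0 => fun _ => 0
  | k + 1 => fun s => ∑ a, π.prob θ s a *
      (meanReward P s a + γ * ∑ s', transProb P s a s' * valueToGo γ θ k s')

/-- The state-action value of an action that is followed by `k` further steps. -/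
noncomputable def qToGo (γ : ℝ) (θ : Param d) (k : ℕ) (s : S) (a : A) : ℝ :=
  meanReward P s a + γ * ∑ s', transProb P s a s' * valueToGo P π γ θ k s'

lemma norm_sum_prob_smul_le (θ : Param d) (s : S) {f : A → F} {M : ℝ} (hf : ∀ a, ‖f a‖ ≤ M) :
    ‖∑ a, π.prob θ s a • f a‖ ≤ M := by
  calc _ ≤ ∑ a, π.prob θ s a * M := norm_sum_le_of_le _ fun a _ => by
          rw [norm_smul, Real.norm_of_nonneg (π.prob_pos θ s a).le]
          exact mul_le_mul_of_nonneg_left (hf a) (π.prob_pos θ s a).le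
    _ = M := by rw [← Finset.sum_mul, π.prob_sum, one_mul]

lemma norm_sum_transProb_smul_le [MeasurableSingletonClass S] (s : S) (a : A) {g : S → F} {M : ℝ}
    (hg : ∀ s, ‖g s‖ ≤ M) : ‖∑ s', transProb P s a s' • g s'‖ ≤ M := by
  calc _ ≤ ∑ s', transProb P s a s' * M := norm_sum_le_of_le _ fun s' _ => by
          rw [norm_smul, Real.norm_of_nonneg (transProb_nonneg P s a s')]
          exact mul_le_mul_of_nonneg_left (hg s') (transProb_nonneg P s a s')
    _ = M := by rw [← Finset.sum_mul, sum_transProb, one_mul]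

lemma stepMean_sub (θ : Param d) (g g' : S → F) (s : S) :
    stepMean P π θ (fun s => g s - g' s) s = stepMean P π θ g s - stepMean P π θ g' s := by
  simp only [stepMean, smul_sub, Finset.sum_sub_distrib]

lemma stepMean_smul (θ : Param d) (c : ℝ) (g : S → F) (s : S) :
    stepMean P π θ (fun s => c • g s) s = c • stepMean P π θ g s := by
  simp only [stepMean, Finset.smul_sum, smul_smul]
  refine Finset.sum_congr rfl fun a _ => Finset.sum_congr rfl fun s' _ => ?_
  ring_nf

lemma stepMean_sum {ι : Type*} (θ : Param d) (I : Finset ι) (g : ι → S → F) (s : S) :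
    stepMean P π θ (fun s => ∑ i ∈ I, g i s) s = ∑ i ∈ I, stepMean P π θ (g i) s := by
  simp only [stepMean, Finset.smul_sum]
  rw [Finset.sum_comm]
  have : ∀ a, ∑ s', ∑ i ∈ I, π.prob θ s a • transProb P s a s' • g i s'
      = ∑ i ∈ I, ∑ s', π.prob θ s a • transProb P s a s' • g i s' := fun a => Finset.sum_comm
  rw [Finset.sum_comm]
  simp only [this]
  exact Finset.sum_comm

lemma norm_stepMean_le [MeasurableSingletonClass S] (θ : Param d) (s : S) {g : S → F} {M : ℝ}
    (hg : ∀ s, ‖g s‖ ≤ M) : ‖stepMean P π θ g s‖ ≤ M :=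
  norm_sum_prob_smul_le π θ s fun a => norm_sum_transProb_smul_le P s a hg

lemma norm_visitMean_le [MeasurableSingletonClass S] (θ : Param d) {f : S → A → F} {M : ℝ}
    (hf : ∀ s a, ‖f s a‖ ≤ M) (t : ℕ) (s : S) : ‖visitMean P π θ f t s‖ ≤ M := by
  induction t generalizing s with
  | zero => exact norm_sum_prob_smul_le π θ s (hf s)
  | succ t ih => exact norm_stepMean_le P π θ s ih

lemma visitMean_sub (θ : Param d) (f f' : S → A → F) (t : ℕ) (s : S) :
    visitMean P π θ (fun s a => f s a - f' s a) t s
      = visitMean P π θ f t s - visitMean P π θ f' t s := by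
  induction t generalizing s with
  | zero => simp only [visitMean, smul_sub, Finset.sum_sub_distrib]
  | succ t ih =>
    simp only [visitMean, funext ih]
    exact stepMean_sub P π θ _ _ s

/-- A function of the state alone is a valid baseline: its product with the score is centred. -/
lemma visitMean_smul_score (θ : Param d) (v : S → ℝ) (t : ℕ) (s : S) :
    visitMean P π θ (fun s a => v s • π.score θ s a) t s = 0 := by
  induction t generalizing s with
  | zero =>
    simp only [visitMean, smul_comm _ (v _), ← Finset.smul_sum, sum_prob_smul_score, smul_zero]
  | succ t ih => simp [visitMean, stepMean, ih]

/-- The law of `(S_t, A_t)` depends on the policy parameter in a Lipschitz way, each of the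
`t + 1` action choices contributing `Pistar` to the constant. -/
lemma norm_visitMean_sub_le [MeasurableSingletonClass S] {Pistar : ℝ}
    (hscore : ∀ θ s a, ‖π.score θ s a‖ ≤ Pistar) (θ θ' : Param d) {f : S → A → F} {M : ℝ}
    (hM : 0 ≤ M) (hf : ∀ s a, ‖f s a‖ ≤ M) (t : ℕ) (s : S) :
    ‖visitMean P π θ f t s - visitMean P π θ' f t s‖ ≤ (t + 1) * Pistar * M * ‖θ - θ'‖ := by
  induction t generalizing s with
  | zero =>
    simp only [visitMean, ← Finset.sum_sub_distrib, ← sub_smul]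
    refine (norm_sum_prob_sub_smul_le π hscore θ θ' s (hf s) hM).trans (le_of_eq ?_)
    push_cast
    ring
  | succ t ih =>
    have h : visitMean P π θ f (t + 1) s - visitMean P π θ' f (t + 1) s
        = ∑ a, (π.prob θ s a - π.prob θ' s a) •
            (∑ s', transProb P s a s' • visitMean P π θ f t s')
          + stepMean P π θ' (fun s => visitMean P π θ f t s - visitMean P π θ' f t s) s := by
      rw [stepMean_sub]
      simp only [visitMean, stepMean, sub_smul, Finset.sum_sub_distrib]
      abel
    rw [h]
    refine (norm_add_le _ _).trans ((add_le_add (norm_sum_prob_sub_smul_le π hscore θ θ' s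
      (fun a => norm_sum_transProb_smul_le P s a (norm_visitMean_le P π θ hf t)) hM)
      (norm_stepMean_le P π θ' s ih)).trans (le_of_eq ?_))
    push_cast
    ring

lemma valueToGo_succ (γ : ℝ) (θ : Param d) (k : ℕ) (s : S) :
    valueToGo P π γ θ (k + 1) s = ∑ a, π.prob θ s a * qToGo P π γ θ k s a := rfl

lemma abs_valueToGo_le [MeasurableSingletonClass S] {γ Rstar : ℝ} (hγ : 0 ≤ γ)
    (hr : ∀ s a, |meanReward P s a| ≤ Rstar) (θ : Param d) (k : ℕ) (s : S) :
    |valueToGo P π γ θ k s| ≤ Rstar * ∑ i ∈ Finset.range k, γ ^ i := by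
  induction k generalizing s with
  | zero => simp [valueToGo]
  | succ k ih =>
    refine norm_sum_prob_smul_le (F := ℝ) π θ s fun a => ?_
    rw [Real.norm_eq_abs]
    refine (abs_add_le _ _).trans ((add_le_add (hr s a) ?_).trans_eq
      (b := Rstar + γ * (Rstar * ∑ i ∈ Finset.range k, γ ^ i)) ?_)
    · rw [abs_mul, abs_of_nonneg hγ]
      exact mul_le_mul_of_nonneg_left (norm_sum_transProb_smul_le (F := ℝ) P s a ih) hγ
    · simp only [Finset.sum_range_succ', pow_succ, ← Finset.sum_mul]
      ring

lemma abs_qToGo_le [MeasurableSingletonClass S] {γ Rstar : ℝ} (hγ : 0 ≤ γ)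
    (hr : ∀ s a, |meanReward P s a| ≤ Rstar) (θ : Param d) (k : ℕ) (s : S) (a : A) :
    |qToGo P π γ θ k s a| ≤ Rstar * ∑ i ∈ Finset.range (k + 1), γ ^ i := by
  refine (abs_add_le _ _).trans ((add_le_add (hr s a) ?_).trans_eq
      (b := Rstar + γ * (Rstar * ∑ i ∈ Finset.range k, γ ^ i)) ?_)
  · rw [abs_mul, abs_of_nonneg hγ]
    exact mul_le_mul_of_nonneg_left
      (norm_sum_transProb_smul_le (F := ℝ) P s a (abs_valueToGo_le P π hγ hr θ k)) hγ
  · simp only [Finset.sum_range_succ', pow_succ, ← Finset.sum_mul]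
    ring

/-- The policy gradient `∑ t < k, γ^t E[Q_t(S_t, A_t) ∇ log π_θ(A_t; S_t) | S_0 = s]` for the
horizon `k`. -/
noncomputable def policyGradient (γ : ℝ) (θ : Param d) (k : ℕ) (s : S) : Param d :=
  ∑ t ∈ Finset.range k, γ ^ t •
    visitMean P π θ (fun s a => qToGo P π γ θ (k - 1 - t) s a • π.score θ s a) t s

lemma policyGradient_succ (γ : ℝ) (θ : Param d) (k : ℕ) (s : S) :
    policyGradient P π γ θ (k + 1) s =
      ∑ a, π.prob θ s a • qToGo P π γ θ k s a • π.score θ s a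
        + γ • stepMean P π θ (policyGradient P π γ θ k) s := by
  have h : policyGradient P π γ θ k = fun s => ∑ t ∈ Finset.range k, γ ^ t •
    visitMean P π θ (fun s a => qToGo P π γ θ (k - 1 - t) s a • π.score θ s a) t s := rfl
  rw [h, stepMean_sum, policyGradient, Finset.sum_range_succ', add_comm, Finset.smul_sum]
  congr 1
  · simp [visitMean]
  · refine Finset.sum_congr rfl fun t _ => ?_
    rw [stepMean_smul, smul_smul, ← pow_succ', show k + 1 - 1 - (t + 1) = k - 1 - t by omega]
    rfl

/-- The policy gradient theorem for a finite horizon. -/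
lemma hasGradientAt_valueToGo (γ : ℝ) (θ : Param d) (k : ℕ) (s : S) :
    HasGradientAt (fun ϑ => valueToGo P π γ ϑ k s) (policyGradient P π γ θ k s) θ := by
  induction k generalizing s with
  | zero => simpa [policyGradient, valueToGo] using hasGradientAt_const θ (0 : ℝ)
  | succ k ih =>
    have hq : ∀ a, HasFDerivAt (fun ϑ => qToGo P π γ ϑ k s a)
        (γ • ∑ s', transProb P s a s' •
          InnerProductSpace.toDual ℝ (Param d) (policyGradient P π γ θ k s')) θ := fun a =>
      ((HasFDerivAt.fun_sum fun s' _ => (ih s').hasFDerivAt.const_mul _).const_mul γ).const_add _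
    have h := HasFDerivAt.fun_sum (u := Finset.univ) fun a _ =>
      (hasFDerivAt_prob π θ s a).mul (hq a)
    rw [hasGradientAt_iff_hasFDerivAt]
    refine h.congr_fderiv ?_
    rw [policyGradient_succ, stepMean]
    simp only [map_add, map_sum, map_smul, Finset.sum_add_distrib, Finset.smul_sum]
    rw [add_comm]
    congr 1
    · refine Finset.sum_congr rfl fun a _ => ?_
      rw [smul_comm]
    · refine Finset.sum_congr rfl fun a _ => Finset.sum_congr rfl fun s' _ => ?_
      rw [smul_comm]

lemma norm_policyGradient_le [MeasurableSingletonClass S] {γ Rstar Pistar : ℝ} (hγ : 0 ≤ γ)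
    (hr : ∀ s a, |meanReward P s a| ≤ Rstar) (hscore : ∀ θ s a, ‖π.score θ s a‖ ≤ Pistar)
    (θ : Param d) (k : ℕ) (s : S) :
    ‖policyGradient P π γ θ k s‖ ≤ Rstar * Pistar *
      ∑ t ∈ Finset.range k, γ ^ t * ∑ j ∈ Finset.range (k - t), γ ^ j := by
  rw [Finset.mul_sum]
  refine norm_sum_le_of_le _ fun t ht => ?_
  rw [norm_smul, norm_pow, Real.norm_of_nonneg hγ, mul_left_comm]
  refine mul_le_mul_of_nonneg_left (norm_visitMean_le P π θ (fun s a => ?_) t s) (pow_nonneg hγ t)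
  have h := abs_qToGo_le P π hγ hr θ (k - 1 - t) s a
  rw [show k - 1 - t + 1 = k - t by have := Finset.mem_range.1 ht; omega] at h
  rw [norm_smul, Real.norm_eq_abs]
  calc _ ≤ (Rstar * ∑ j ∈ Finset.range (k - t), γ ^ j) * Pistar :=
        mul_le_mul h (hscore θ s a) (norm_nonneg _) ((abs_nonneg _).trans h)
    _ = _ := by ring

lemma abs_valueToGo_sub_le [MeasurableSingletonClass S] {γ Rstar Pistar : ℝ} (hγ : 0 ≤ γ)
    (hr : ∀ s a, |meanReward P s a| ≤ Rstar) (hscore : ∀ θ s a, ‖π.score θ s a‖ ≤ Pistar)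
    (θ θ' : Param d) (k : ℕ) (s : S) :
    |valueToGo P π γ θ k s - valueToGo P π γ θ' k s| ≤ Rstar * Pistar *
      (∑ t ∈ Finset.range k, γ ^ t * ∑ j ∈ Finset.range (k - t), γ ^ j) * ‖θ - θ'‖ := by
  refine convex_univ.norm_image_sub_le_of_norm_hasFDerivWithin_le
    (fun ϑ _ => (hasGradientAt_valueToGo P π γ ϑ k s).hasFDerivAt.hasFDerivWithinAt)
    (fun ϑ _ => ?_) (Set.mem_univ θ') (Set.mem_univ θ)
  rw [LinearIsometryEquiv.norm_map]
  exact norm_policyGradient_le P π hγ hr hscore ϑ k s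

lemma abs_qToGo_sub_le [MeasurableSingletonClass S] {γ Rstar Pistar : ℝ} (hγ : 0 ≤ γ)
    (hr : ∀ s a, |meanReward P s a| ≤ Rstar) (hscore : ∀ θ s a, ‖π.score θ s a‖ ≤ Pistar)
    (θ θ' : Param d) (k : ℕ) (s : S) (a : A) :
    |qToGo P π γ θ k s a - qToGo P π γ θ' k s a| ≤ γ * (Rstar * Pistar *
      (∑ t ∈ Finset.range k, γ ^ t * ∑ j ∈ Finset.range (k - t), γ ^ j) * ‖θ - θ'‖) := by
  have h : qToGo P π γ θ k s a - qToGo P π γ θ' k s a = γ * ∑ s', transProb P s a s' •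
      (valueToGo P π γ θ k s' - valueToGo P π γ θ' k s') := by
    simp only [qToGo, smul_eq_mul, mul_sub, Finset.sum_sub_distrib]
    ring
  rw [h, abs_mul, abs_of_nonneg hγ]
  exact mul_le_mul_of_nonneg_left (norm_sum_transProb_smul_le (F := ℝ) P s a
    (abs_valueToGo_sub_le P π hγ hr hscore θ θ' k)) hγ

/-- Three sources of variation of the policy gradient: the score, the state-action value, and the
law of `(S_t, A_t)`. They give the three summands of the smoothness constant. -/
lemma norm_policyGradient_sub_le [MeasurableSingletonClass S] [Nonempty A]
    {γ Rstar Pistar Ls : ℝ} (hγ : 0 ≤ γ)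
    (hr : ∀ s a, |meanReward P s a| ≤ Rstar) (hscore : ∀ θ s a, ‖π.score θ s a‖ ≤ Pistar)
    (hscoreLip : ∀ θ θ' s a, ‖π.score θ s a - π.score θ' s a‖ ≤ Ls * ‖θ - θ'‖)
    (θ θ' : Param d) (k : ℕ) (s : S) :
    ‖policyGradient P π γ θ k s - policyGradient P π γ θ' k s‖ ≤
      smoothnessConst k γ Rstar Pistar Ls * ‖θ - θ'‖ := by
  obtain ⟨a₀⟩ := ‹Nonempty A›
  have hR0 : 0 ≤ Rstar := (abs_nonneg _).trans (hr s a₀)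
  have hP0 : 0 ≤ Pistar := (norm_nonneg _).trans (hscore θ s a₀)
  have hL0 : 0 ≤ Ls * ‖θ - θ'‖ := (norm_nonneg _).trans (hscoreLip θ θ' s a₀)
  rw [policyGradient, policyGradient, ← Finset.sum_sub_distrib, smoothnessConst, Finset.mul_sum,
    Finset.sum_mul]
  refine norm_sum_le_of_le _ fun t ht => ?_
  have htk := Finset.mem_range.1 ht
  set g := ∑ j ∈ Finset.range (k - t), γ ^ j with hg
  have hg0 : 0 ≤ g := Finset.sum_nonneg fun _ _ => pow_nonneg hγ _
  set c := ∑ i ∈ Finset.range (k - t - 1), γ ^ i * ∑ j ∈ Finset.range (k - t - 1 - i), γ ^ j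
    with hc
  have hq : ∀ θ s a, |qToGo P π γ θ (k - 1 - t) s a| ≤ Rstar * g := fun θ s a => by
    have h := abs_qToGo_le P π hγ hr θ (k - 1 - t) s a
    rwa [show k - 1 - t + 1 = k - t by omega] at h
  have hqd : ∀ s a, |qToGo P π γ θ (k - 1 - t) s a - qToGo P π γ θ' (k - 1 - t) s a|
      ≤ γ * (Rstar * Pistar * c * ‖θ - θ'‖) := fun s a => by
    have h := abs_qToGo_sub_le P π hγ hr hscore θ θ' (k - 1 - t) s a
    rwa [show k - 1 - t = k - t - 1 by omega] at h ⊢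
  have hqs : ∀ s a, ‖qToGo P π γ θ' (k - 1 - t) s a • π.score θ' s a‖ ≤ Rstar * g * Pistar :=
    fun s a => by
      rw [norm_smul, Real.norm_eq_abs]
      exact mul_le_mul (hq θ' s a) (hscore θ' s a) (norm_nonneg _) (mul_nonneg hR0 hg0)
  have hfd : ∀ s a, ‖qToGo P π γ θ (k - 1 - t) s a • π.score θ s a
      - qToGo P π γ θ' (k - 1 - t) s a • π.score θ' s a‖
      ≤ Rstar * g * (Ls * ‖θ - θ'‖) + γ * (Rstar * Pistar * c * ‖θ - θ'‖) * Pistar := fun s a => by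
    have h : qToGo P π γ θ (k - 1 - t) s a • π.score θ s a
        - qToGo P π γ θ' (k - 1 - t) s a • π.score θ' s a
        = qToGo P π γ θ (k - 1 - t) s a • (π.score θ s a - π.score θ' s a)
          + (qToGo P π γ θ (k - 1 - t) s a - qToGo P π γ θ' (k - 1 - t) s a) • π.score θ' s a := by
      rw [smul_sub, sub_smul]; abel
    rw [h]
    refine (norm_add_le _ _).trans (add_le_add ?_ ?_)
    · rw [norm_smul, Real.norm_eq_abs]
      exact mul_le_mul (hq θ s a) (hscoreLip θ θ' s a) (norm_nonneg _) (mul_nonneg hR0 hg0)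
    · rw [norm_smul, Real.norm_eq_abs]
      exact mul_le_mul (hqd s a) (hscore θ' s a) (norm_nonneg _) ((abs_nonneg _).trans (hqd s a))
  have h1 := norm_visitMean_le P π θ hfd t s
  rw [visitMean_sub] at h1
  have h2 := norm_visitMean_sub_le P π hscore θ θ' (by positivity) hqs t s
  rw [← smul_sub, norm_smul, norm_pow, Real.norm_of_nonneg hγ, mul_left_comm, mul_assoc]
  refine mul_le_mul_of_nonneg_left (((norm_sub_le_norm_sub_add_norm_sub _ _ _).trans
    (add_le_add h1 h2)).trans (le_of_eq ?_)) (pow_nonneg hγ t)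
  ring

end FiniteModel

/-! ### Integration over controlled chains -/

section Chain

variable {X Y : Type*} [MeasurableSpace X] [MeasurableSpace Y] {κ : Kernel X Y}
  [IsMarkovKernel κ] {next : X × Y → X} (hnext : Measurable next)

lemma ae_chain_succ {k : ℕ} {x : X} {p : (Fin (k + 1) → Y) → Prop} (hp : MeasurableSet {ω | p ω})
    (h : ∀ᵐ y ∂(κ x), ∀ᵐ z ∂(chain κ next hnext k (next (x, y))), p (Fin.cons y z)) :
    ∀ᵐ ω ∂(chain κ next hnext (k + 1) x), p ω := by
  rw [chain, Kernel.map_apply _ measurable_finCons, ae_map_iff measurable_finCons.aemeasurable hp]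
  refine Kernel.ae_compProd_of_ae_ae (measurable_finCons hp) ?_
  filter_upwards [h] with y hy
  rwa [Kernel.comap_apply]

lemma ae_chain {p : Y → Prop} (hp : MeasurableSet {y | p y}) (h : ∀ x, ∀ᵐ y ∂(κ x), p y)
    (k : ℕ) (x : X) : ∀ᵐ ω ∂(chain κ next hnext k x), ∀ i, p (ω i) := by
  induction k generalizing x with
  | zero => exact ae_of_all _ fun _ i => i.elim0
  | succ k ih =>
    have hm : MeasurableSet {ω : Fin (k + 1) → Y | ∀ i, p (ω i)} := by
      simp only [Set.ofPred_forall]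
      exact MeasurableSet.iInter fun i => measurable_pi_apply i hp
    refine ae_chain_succ hnext hm ?_
    filter_upwards [h x] with y hy
    filter_upwards [ih (next (x, y))] with z hz
    exact fun i => Fin.cases (by simpa using hy) (fun j => by simpa using hz j) i

lemma integral_chain_succ {F : Type*} [NormedAddCommGroup F] [NormedSpace ℝ F] {k : ℕ} {x : X}
    {f : (Fin (k + 1) → Y) → F} (hf : Integrable f (chain κ next hnext (k + 1) x)) :
    ∫ ω, f ω ∂(chain κ next hnext (k + 1) x)
      = ∫ y, ∫ z, f (Fin.cons y z) ∂(chain κ next hnext k (next (x, y))) ∂(κ x) := by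
  rw [chain, Kernel.map_apply _ measurable_finCons] at hf ⊢
  rw [integral_map measurable_finCons.aemeasurable hf.aestronglyMeasurable,
    ProbabilityTheory.integral_compProd
      (f := fun z : Y × (Fin k → Y) => f (Fin.cons z.1 z.2))
      (hf.comp_measurable measurable_finCons)]
  simp only [Kernel.comap_apply]

end Chain

/-! ### Rollouts and value functions -/

section Rollouts

variable {d : ℕ} {S A : Type*} [Fintype S] [MeasurableSpace S] [MeasurableSingletonClass S]
  [Fintype A] [MeasurableSpace A] [MeasurableSingletonClass A]
  (P : MDP S A) (π : PolicyFamily d S A)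
  {F : Type*} [NormedAddCommGroup F] [NormedSpace ℝ F]

lemma transitionKernel_apply (θ : Param d) (s : S) :
    transitionKernel P π (θ, s)
      = ∑ a, ENNReal.ofReal (π.prob θ s a) • (P.step (s, a)).map fun y => (s, a, y) := by
  have hm : ∀ a : A, Measurable fun y : ℝ × S => (s, a, y) := fun a => by fun_prop
  ext U hU
  rw [transitionKernel, Kernel.prod_apply, Kernel.deterministic_apply, Measure.dirac_prod,
    Measure.map_apply measurable_prodMk_left hU,
    Kernel.compProd_apply (measurable_prodMk_left hU)]
  simp only [PolicyFamily.actionKernel, Kernel.coe_mk, lintegral_finsetSum_measure,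
    lintegral_smul_measure, lintegral_dirac, Measure.finsetSum_apply, Measure.smul_apply,
    Kernel.comap_apply, Measure.map_apply (hm _) hU]
  rfl

lemma ae_transitionKernel {p : Transition S A → Prop} (hp : MeasurableSet {y | p y})
    (θ : Param d) (s : S) (h : ∀ a, ∀ᵐ y ∂(P.step (s, a)), p (s, a, y)) :
    ∀ᵐ y ∂(transitionKernel P π (θ, s)), p y := by
  have hm : ∀ a : A, Measurable fun y : ℝ × S => (s, a, y) := fun a => by fun_prop
  rw [ae_iff, transitionKernel_apply, Measure.finsetSum_apply]
  refine Finset.sum_eq_zero fun a _ => ?_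
  rw [Measure.smul_apply, smul_eq_mul, ← Set.compl_ofPred, Measure.map_apply (hm a) hp.compl]
  exact mul_eq_zero_of_right _ (h a)

lemma integral_transitionKernel (θ : Param d) (s : S) {f : Transition S A → F}
    (hf : ∀ a, Integrable (fun y => f (s, a, y)) (P.step (s, a)))
    (hfm : StronglyMeasurable f) :
    ∫ y, f y ∂(transitionKernel P π (θ, s))
      = ∑ a, π.prob θ s a • ∫ y, f (s, a, y) ∂(P.step (s, a)) := by
  have hm : ∀ a : A, Measurable fun y : ℝ × S => (s, a, y) := fun a => by fun_prop
  rw [transitionKernel_apply, integral_finsetSum_measure]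
  · refine Finset.sum_congr rfl fun a _ => ?_
    rw [integral_smul_measure, integral_map (hm a).aemeasurable hfm.aestronglyMeasurable,
      ENNReal.toReal_ofReal (π.prob_pos θ s a).le]
  · intro a _
    refine Integrable.smul_measure ?_ ENNReal.ofReal_ne_top
    rw [integrable_map_measure hfm.aestronglyMeasurable (hm a).aemeasurable]
    exact hf a

lemma integral_step_snd [CompleteSpace F] (s : S) (a : A) (g : S → F) :
    ∫ y, g y.2 ∂(P.step (s, a)) = ∑ s', transProb P s a s' • g s' := by
  have := Measure.isProbabilityMeasure_map (μ := P.step (s, a)) measurable_snd.aemeasurable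
  rw [← integral_map (φ := Prod.snd) measurable_snd.aemeasurable
    (StronglyMeasurable.of_discrete).aestronglyMeasurable, integral_fintype Integrable.of_finite]
  refine Finset.sum_congr rfl fun s' _ => ?_
  rw [map_measureReal_apply measurable_snd (measurableSet_singleton s')]
  rfl

lemma integrable_step_snd (s : S) (a : A) (g : S → F) :
    Integrable (fun y : ℝ × S => g y.2) (P.step (s, a)) := by
  have := Measure.isProbabilityMeasure_map (μ := P.step (s, a)) measurable_snd.aemeasurable
  exact (Integrable.of_finite (μ := (P.step (s, a)).map Prod.snd) (f := g)).comp_measurable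
    measurable_snd

lemma integrable_visit {k : ℕ} (μ : Measure (Fin k → Transition S A)) [IsFiniteMeasure μ]
    (f : S → A → F) (t : Fin k) : Integrable (fun τ => f (τ t).1 (τ t).2.1) μ := by
  have hm : Measurable fun τ : Fin k → Transition S A => ((τ t).1, (τ t).2.1) := by fun_prop
  exact (Integrable.of_finite (μ := μ.map _) (f := fun z : S × A => f z.1 z.2)).comp_measurable hm

lemma integral_rolloutFrom_visit [CompleteSpace F] (θ : Param d) (f : S → A → F) {k : ℕ}
    (t : Fin k) (s : S) :
    ∫ τ, f (τ t).1 (τ t).2.1 ∂(rolloutFrom P π k (θ, s)) = visitMean P π θ f t s := by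
  induction k generalizing s with
  | zero => exact t.elim0
  | succ k ih =>
    rw [rolloutFrom, integral_chain_succ _ (integrable_visit _ f t)]
    refine Fin.cases ?_ (fun t => ?_) t
    · simp only [Fin.cons_zero, integral_const, probReal_univ, one_smul]
      have hm : Measurable fun y : Transition S A => (y.1, y.2.1) := by fun_prop
      rw [integral_transitionKernel]
      · simp only [integral_const, probReal_univ, one_smul]
        rfl
      · exact fun a => integrable_const (f s a)
      · exact (StronglyMeasurable.of_discrete (f := fun z : S × A => f z.1 z.2)).comp_measurable hm
    · simp only [Fin.cons_succ]
      change ∫ y, ∫ τ, f (τ t).1 (τ t).2.1 ∂(rolloutFrom P π k (θ, y.2.2.2))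
        ∂(transitionKernel P π (θ, s)) = _
      simp only [ih]
      have hm : Measurable fun y : Transition S A => y.2.2.2 := by fun_prop
      rw [integral_transitionKernel]
      · simp only [integral_step_snd P s _ (visitMean P π θ f t)]
        rfl
      · exact fun a => integrable_step_snd P s a (visitMean P π θ f t)
      · exact (StronglyMeasurable.of_discrete (f := visitMean P π θ f t)).comp_measurable hm

lemma discountedReturn_cons (γ : ℝ) {k : ℕ} (y : Transition S A) (τ : Fin k → Transition S A) :
    discountedReturn γ (Fin.cons y τ : Fin (k + 1) → Transition S A)
      = y.2.2.1 + γ * discountedReturn γ τ := by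
  simp only [discountedReturn, Fin.sum_univ_succ, Fin.cons_zero, Fin.cons_succ, Fin.val_zero,
    Fin.val_succ, pow_zero, one_mul, Finset.mul_sum, pow_succ]
  congr 1
  exact Finset.sum_congr rfl fun i _ => by ring

lemma measurable_discountedReturn (γ : ℝ) (k : ℕ) :
    Measurable fun τ : Fin k → Transition S A => discountedReturn γ τ := by
  unfold discountedReturn
  fun_prop

variable {Rstar : ℝ}

lemma integrable_reward (hR : ∀ s a, ∀ᵐ x ∂(P.step (s, a)), |x.1| ≤ Rstar) (s : S) (a : A) :
    Integrable (fun x : ℝ × S => x.1) (P.step (s, a)) :=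
  Integrable.of_bound measurable_fst.aestronglyMeasurable Rstar (hR s a)

lemma abs_meanReward_le (hR : ∀ s a, ∀ᵐ x ∂(P.step (s, a)), |x.1| ≤ Rstar) (s : S) (a : A) :
    |meanReward P s a| ≤ Rstar := by
  have h := norm_integral_le_of_norm_le_const (f := fun x : ℝ × S => x.1) (hR s a)
  simpa only [meanReward, probReal_univ, mul_one, Real.norm_eq_abs] using h

lemma integrable_discountedReturn (hR : ∀ s a, ∀ᵐ x ∂(P.step (s, a)), |x.1| ≤ Rstar)
    (γ : ℝ) (θ : Param d) (k : ℕ) (s : S) :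
    Integrable (fun τ => discountedReturn γ τ) (rolloutFrom P π k (θ, s)) := by
  have hm : MeasurableSet {y : Transition S A | |y.2.2.1| ≤ Rstar} :=
    measurableSet_le (by fun_prop) measurable_const
  have h : ∀ᵐ τ ∂(rolloutFrom P π k (θ, s)), ∀ i, |(τ i).2.2.1| ≤ Rstar :=
    ae_chain (κ := transitionKernel P π) (p := fun y => |y.2.2.1| ≤ Rstar) _ hm
      (fun x => ae_transitionKernel P π hm x.1 x.2 fun a => hR x.2 a) k (θ, s)
  refine Integrable.of_bound (measurable_discountedReturn γ k).aestronglyMeasurable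
    (∑ i : Fin k, |γ| ^ (i : ℕ) * Rstar) ?_
  filter_upwards [h] with τ hτ
  refine norm_sum_le_of_le _ fun i _ => ?_
  rw [norm_mul, norm_pow]
  exact mul_le_mul_of_nonneg_left (hτ i) (pow_nonneg (abs_nonneg γ) _)

lemma integral_discountedReturn (hR : ∀ s a, ∀ᵐ x ∂(P.step (s, a)), |x.1| ≤ Rstar)
    (γ : ℝ) (θ : Param d) (k : ℕ) (s : S) :
    ∫ τ, discountedReturn γ τ ∂(rolloutFrom P π k (θ, s)) = valueToGo P π γ θ k s := by
  induction k generalizing s with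
  | zero => simp [discountedReturn, valueToGo]
  | succ k ih =>
    have hint := integrable_discountedReturn P π hR γ θ (k + 1) s
    rw [rolloutFrom] at hint ⊢
    rw [integral_chain_succ _ hint]
    change ∫ y, ∫ τ, discountedReturn γ (Fin.cons y τ : Fin (k + 1) → Transition S A)
      ∂(rolloutFrom P π k (θ, y.2.2.2)) ∂(transitionKernel P π (θ, s)) = _
    have h : ∀ y : Transition S A,
        ∫ τ, discountedReturn γ (Fin.cons y τ : Fin (k + 1) → Transition S A)
          ∂(rolloutFrom P π k (θ, y.2.2.2)) = y.2.2.1 + γ * valueToGo P π γ θ k y.2.2.2 := by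
      intro y
      simp only [discountedReturn_cons]
      rw [integral_add (integrable_const _)
        ((integrable_discountedReturn P π hR γ θ k _).const_mul γ), integral_const_mul, ih]
      simp
    simp only [h]
    have hm : Measurable fun y : Transition S A => y.2.2.2 := by fun_prop
    rw [integral_transitionKernel, valueToGo_succ]
    · refine Finset.sum_congr rfl fun a _ => ?_
      rw [integral_add (integrable_reward P hR s a)
        ((integrable_step_snd P s a (valueToGo P π γ θ k)).const_mul γ), integral_const_mul,
        integral_step_snd P s a (valueToGo P π γ θ k)]
      rfl
    · exact fun a => (integrable_reward P hR s a).add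
        ((integrable_step_snd P s a (valueToGo P π γ θ k)).const_mul γ)
    · exact (Measurable.add (by fun_prop)
        (((measurable_of_finite (valueToGo P π γ θ k)).comp hm).const_mul γ)).stronglyMeasurable

lemma value_eq_valueToGo (hR : ∀ s a, ∀ᵐ x ∂(P.step (s, a)), |x.1| ≤ Rstar)
    (T : ℕ) (γ : ℝ) (θ : Param d) (t : ℕ) (s : S) :
    value P π T γ θ t s = valueToGo P π γ θ (T - t) s :=
  integral_discountedReturn P π hR γ θ (T - t) s

lemma qValue_eq_qToGo (hR : ∀ s a, ∀ᵐ x ∂(P.step (s, a)), |x.1| ≤ Rstar)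
    (T : ℕ) (γ : ℝ) (θ : Param d) (t : ℕ) (s : S) (a : A) :
    qValue P π T γ θ t s a = qToGo P π γ θ (T - t - 1) s a := by
  rw [qValue]
  generalize T - t - 1 = k
  have : IsMarkovKernel (rolloutFromAction P π k) := by unfold rolloutFromAction; infer_instance
  have hr : Integrable (fun x : (ℝ × S) × (Fin k → Transition S A) => x.1.1)
      (rolloutFromAction P π k (θ, s, a)) := by
    refine Integrable.of_bound (by fun_prop : Measurable _).aestronglyMeasurable Rstar ?_
    refine Kernel.ae_compProd_of_ae_ae
      (measurableSet_le (by fun_prop) measurable_const) ?_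
    filter_upwards [hR s a] with x hx
    exact ae_of_all _ fun _ => hx
  have hd : Integrable (fun x : (ℝ × S) × (Fin k → Transition S A) => discountedReturn γ x.2)
      (rolloutFromAction P π k (θ, s, a)) := by
    have hm : Measurable fun x : (ℝ × S) × (Fin k → Transition S A) => discountedReturn γ x.2 :=
      (measurable_discountedReturn γ k).comp measurable_snd
    refine (integrable_compProd_iff hm.aestronglyMeasurable).2 ⟨ae_of_all _ fun x =>
      integrable_discountedReturn P π hR γ θ k x.2, ?_⟩
    exact integrable_step_snd P s a fun s' =>
      ∫ τ, ‖discountedReturn γ τ‖ ∂(rolloutFrom P π k (θ, s'))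
  have h : ∀ x : ℝ × S, ∫ τ, x.1 + γ * discountedReturn γ τ ∂(rolloutFrom P π k (θ, x.2))
      = x.1 + γ * valueToGo P π γ θ k x.2 := fun x => by
    rw [integral_add (integrable_const _)
      ((integrable_discountedReturn P π hR γ θ k _).const_mul γ), integral_const_mul,
      integral_discountedReturn P π hR]
    simp
  rw [rolloutFromAction, ProbabilityTheory.integral_compProd
    (f := fun x : (ℝ × S) × (Fin k → Transition S A) => x.1.1 + γ * discountedReturn γ x.2)
    (hr.add (hd.const_mul γ))]
  change ∫ x, ∫ τ, x.1 + γ * discountedReturn γ τ ∂(rolloutFrom P π k (θ, x.2)) ∂(P.step (s, a)) = _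
  simp only [h]
  rw [integral_add (integrable_reward P hR s a)
        ((integrable_step_snd P s a (valueToGo P π γ θ k)).const_mul γ), integral_const_mul,
        integral_step_snd P s a (valueToGo P π γ θ k)]
  rfl

lemma rolloutLaw_apply_integral [CompleteSpace F] (T : ℕ) (θ : Param d)
    {f : (Fin T → Transition S A) → F} (hf : Integrable f (rolloutLaw P π T θ)) :
    ∫ τ, f τ ∂(rolloutLaw P π T θ)
      = ∑ s, P.init.real {s} • ∫ τ, f τ ∂(rolloutFrom P π T (θ, s)) := by
  rw [rolloutLaw] at hf ⊢
  rw [Kernel.integral_comp hf, Kernel.prod_apply, Kernel.id_apply, Kernel.const_apply,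
    Measure.dirac_prod, integral_map measurable_prodMk_left.aemeasurable,
    integral_fintype Integrable.of_finite]
  have h := hf.aestronglyMeasurable.integral_kernel_comp
  rwa [Kernel.prod_apply, Kernel.id_apply, Kernel.const_apply, Measure.dirac_prod] at h

lemma integral_sampleLaw_visit [CompleteSpace F] {T : ℕ} (est : Estimator d S A T)
    [IsMarkovKernel est] (θ : Param d) (f : S → A → F) (t : Fin T) :
    ∫ ω, f (ω.1 t).1 (ω.1 t).2.1 ∂(sampleLaw P π est θ)
      = ∑ s, P.init.real {s} • visitMean P π θ f t s := by
  have hfst : (sampleLaw P π est θ).map Prod.fst = rolloutLaw P π T θ := by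
    rw [sampleLaw, ← Kernel.map_apply _ measurable_fst, ← Kernel.fst_eq, Kernel.fst_compProd]
  have hi := integrable_visit (rolloutLaw P π T θ) f t
  rw [← hfst] at hi
  have h := integral_map measurable_fst.aemeasurable hi.aestronglyMeasurable
  rw [← h, hfst, rolloutLaw_apply_integral P π T θ (integrable_visit _ f t)]
  simp only [integral_rolloutFrom_visit]

end Rollouts

/-! ### The objective and its gradient -/

section Objective

variable {d : ℕ} {S A : Type*} [Fintype S] [MeasurableSpace S] [MeasurableSingletonClass S]
  [Fintype A] [MeasurableSpace A] [MeasurableSingletonClass A]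
  (P : MDP S A) (π : PolicyFamily d S A) {Rstar : ℝ}

lemma sum_init : ∑ s, P.init.real {s} = 1 := by
  rw [sum_measureReal_singleton, Finset.coe_univ, probReal_univ]

lemma norm_sum_init_smul_le {F : Type*} [NormedAddCommGroup F] [NormedSpace ℝ F] {f : S → F}
    {M : ℝ} (hf : ∀ s, ‖f s‖ ≤ M) : ‖∑ s, P.init.real {s} • f s‖ ≤ M := by
  calc _ ≤ ∑ s, P.init.real {s} * M := norm_sum_le_of_le _ fun s _ => by
          rw [norm_smul, Real.norm_of_nonneg measureReal_nonneg]
          exact mul_le_mul_of_nonneg_left (hf s) measureReal_nonneg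
    _ = M := by rw [← Finset.sum_mul, sum_init, one_mul]

lemma nonempty_state (P : MDP S A) : Nonempty S :=
  nonempty_of_isProbabilityMeasure P.init

lemma PolicyFamily.nonempty_action (π : PolicyFamily d S A) (s : S) : Nonempty A := by
  by_contra h
  rw [not_nonempty_iff] at h
  simpa using π.prob_sum 0 s

lemma objective_eq (hR : ∀ s a, ∀ᵐ x ∂(P.step (s, a)), |x.1| ≤ Rstar) (T : ℕ) (γ : ℝ) :
    objective P π T γ = fun θ => ∑ s, P.init.real {s} * valueToGo P π γ θ T s := by
  funext θ
  simp only [objective, value_eq_valueToGo P π hR, Nat.sub_zero]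

lemma hasGradientAt_objective (hR : ∀ s a, ∀ᵐ x ∂(P.step (s, a)), |x.1| ≤ Rstar)
    (T : ℕ) (γ : ℝ) (θ : Param d) :
    HasGradientAt (objective P π T γ)
      (∑ s, P.init.real {s} • policyGradient P π γ θ T s) θ := by
  rw [objective_eq P π hR, hasGradientAt_iff_hasFDerivAt]
  simp only [map_sum, map_smul]
  exact HasFDerivAt.fun_sum fun s _ =>
    (hasGradientAt_valueToGo P π γ θ T s).hasFDerivAt.const_mul _

lemma abs_objective_le (hR : ∀ s a, ∀ᵐ x ∂(P.step (s, a)), |x.1| ≤ Rstar)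
    (T : ℕ) {γ : ℝ} (hγ : 0 ≤ γ) (θ : Param d) :
    |objective P π T γ θ| ≤ Rstar * ∑ i ∈ Finset.range T, γ ^ i := by
  rw [objective_eq P π hR]
  exact norm_sum_init_smul_le (F := ℝ) P fun s =>
    abs_valueToGo_le P π hγ (abs_meanReward_le P hR) θ T s

lemma norm_gradient_objective_sub_le (hR : ∀ s a, ∀ᵐ x ∂(P.step (s, a)), |x.1| ≤ Rstar)
    (T : ℕ) {γ Pistar Ls : ℝ} (hγ : 0 ≤ γ) (hscore : ∀ θ s a, ‖π.score θ s a‖ ≤ Pistar)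
    (hscoreLip : ∀ θ θ' s a, ‖π.score θ s a - π.score θ' s a‖ ≤ Ls * ‖θ - θ'‖)
    (θ θ' : Param d) :
    ‖gradient (objective P π T γ) θ - gradient (objective P π T γ) θ'‖
      ≤ smoothnessConst T γ Rstar Pistar Ls * ‖θ - θ'‖ := by
  obtain ⟨s₀⟩ := nonempty_state P
  have := π.nonempty_action s₀
  rw [(hasGradientAt_objective P π hR T γ θ).gradient,
    (hasGradientAt_objective P π hR T γ θ').gradient, ← Finset.sum_sub_distrib]
  simp only [← smul_sub]
  exact norm_sum_init_smul_le P fun s => norm_policyGradient_sub_le P π hγ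
    (abs_meanReward_le P hR) hscore hscoreLip θ θ' T s

/-- The policy gradient theorem in advantage form, as an expectation over a sampled rollout. -/
lemma gradient_objective_eq_sum_integral (hR : ∀ s a, ∀ᵐ x ∂(P.step (s, a)), |x.1| ≤ Rstar)
    {T : ℕ} (γ : ℝ) (est : Estimator d S A T) [IsMarkovKernel est] (θ : Param d) :
    gradient (objective P π T γ) θ = ∑ t : Fin T, γ ^ (t : ℕ) •
      ∫ ω, advantage P π T γ θ t (ω.1 t).1 (ω.1 t).2.1 • π.score θ (ω.1 t).1 (ω.1 t).2.1
        ∂(sampleLaw P π est θ) := by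
  have h : ∀ t : Fin T, ∫ ω, advantage P π T γ θ t (ω.1 t).1 (ω.1 t).2.1 •
      π.score θ (ω.1 t).1 (ω.1 t).2.1 ∂(sampleLaw P π est θ)
      = ∑ s, P.init.real {s} • visitMean P π θ
        (fun s a => qToGo P π γ θ (T - 1 - t) s a • π.score θ s a) t s := fun t => by
    rw [integral_sampleLaw_visit P π est θ (fun s a => advantage P π T γ θ t s a • π.score θ s a)]
    refine Finset.sum_congr rfl fun s _ => ?_
    simp only [advantage, sub_smul, qValue_eq_qToGo P π hR]
    rw [visitMean_sub, visitMean_smul_score, sub_zero, Nat.sub_right_comm]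
  simp only [h, (hasGradientAt_objective P π hR T γ θ).gradient, policyGradient, Finset.smul_sum]
  rw [Finset.sum_comm, ← Fin.sum_univ_eq_sum_range (fun t => ∑ s, P.init.real {s} • γ ^ t •
    visitMean P π θ (fun s a => qToGo P π γ θ (T - 1 - t) s a • π.score θ s a) t s)]
  refine Finset.sum_congr rfl fun t _ => Finset.sum_congr rfl fun s _ => ?_
  rw [smul_comm]

end Objective

/-! ### Averages of independent random vectors -/

section Averages

variable {Ω : Type*} [MeasurableSpace Ω] (q : Measure Ω) [IsProbabilityMeasure q]

lemma abs_integral_le_of_integral_sq_le {Z : Ω → ℝ} (hZ : MemLp Z 2 q) {δ : ℝ} (hδ : 0 ≤ δ)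
    (h : ∫ ω, Z ω ^ 2 ∂q ≤ δ ^ 2) : |∫ ω, Z ω ∂q| ≤ δ := by
  -- the variance is nonnegative, so the square of the mean is at most the mean of the square
  have h1 := variance_nonneg Z q
  rw [variance_eq_sub hZ] at h1
  exact abs_le_of_sq_le_sq (by simp only [Pi.pow_apply] at h1; linarith) hδ

lemma integral_sq_average_sub_le {n : ℕ} (hn : 0 < n) {X : Ω → ℝ} (hX : MemLp X 2 q) (g : ℝ) :
    ∫ ω, ((n : ℝ)⁻¹ * ∑ j, X (ω j) - g) ^ 2 ∂(Measure.pi fun _ : Fin n => q)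
      ≤ (∫ ω, X ω ^ 2 ∂q) / n + (∫ ω, X ω ∂q - g) ^ 2 := by
  have hn' : (n : ℝ) ≠ 0 := by positivity
  have hmp := fun j : Fin n => measurePreserving_eval (fun _ : Fin n => q) j
  have hXj : ∀ j : Fin n, MemLp (fun ω : Fin n → Ω => X (ω j)) 2 (Measure.pi fun _ => q) :=
    fun j => hX.comp_measurePreserving (hmp j)
  set Y : (Fin n → Ω) → ℝ := fun ω => (n : ℝ)⁻¹ * ∑ j, X (ω j) with hY
  have hYL : MemLp Y 2 (Measure.pi fun _ => q) := (memLp_finsetSum _ fun j _ => hXj j).const_mul _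
  have hmean : ∫ ω, Y ω ∂(Measure.pi fun _ => q) = ∫ ω, X ω ∂q := by
    rw [integral_const_mul, integral_finsetSum _ fun j _ => (hXj j).integrable (by norm_num)]
    have : ∀ j : Fin n, ∫ ω, X (ω j) ∂(Measure.pi fun _ => q) = ∫ ω, X ω ∂q := fun j => by
      have h := integral_map (f := X) (hmp j).measurable.aemeasurable
        (by rw [(hmp j).map_eq]; exact hX.aestronglyMeasurable)
      rw [(hmp j).map_eq] at h
      exact h.symm
    simp only [this, Finset.sum_const, Finset.card_univ, Fintype.card_fin, nsmul_eq_mul]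
    field_simp
  have hvar : Var[Y; Measure.pi fun _ => q] = Var[X; q] / n := by
    have h := variance_sum_pi (μ := fun _ : Fin n => q) (X := fun _ => X) fun _ => hX
    have h2 : Y = fun ω => (n : ℝ)⁻¹ * (∑ j, fun ω : Fin n → Ω => X (ω j)) ω := by
      funext ω; simp [hY]
    rw [h2, variance_const_mul, h]
    simp only [Finset.sum_const, Finset.card_univ, Fintype.card_fin, nsmul_eq_mul]
    field_simp
  have hYs := variance_eq_sub (hYL.sub (memLp_const g))
  have hsub : Var[Y - fun _ => g; Measure.pi fun _ => q] = Var[Y; Measure.pi fun _ => q] :=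
    variance_sub_const hYL.aestronglyMeasurable g
  have hm2 : ∫ ω, (Y ω - g) ∂(Measure.pi fun _ => q) = ∫ ω, X ω ∂q - g := by
    rw [integral_sub (hYL.integrable (by norm_num)) (integrable_const _), hmean]
    simp
  simp only [Pi.pow_apply, Pi.sub_apply] at hYs
  rw [hsub, hvar, hm2] at hYs
  have hle : Var[X; q] / n ≤ (∫ ω, X ω ^ 2 ∂q) / n := by
    gcongr
    exact variance_le_expectation_sq hX.aestronglyMeasurable
  linarith

/-- Bias-variance bound for the average of `n` independent copies of a bounded random vector. -/
lemma integral_norm_sq_average_sub_le {d n : ℕ} (hn : 0 < n) {X : Ω → EuclideanSpace ℝ (Fin d)}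
    (hX : Measurable X) {M : ℝ} (hM : ∀ᵐ ω ∂q, ‖X ω‖ ≤ M) (g : EuclideanSpace ℝ (Fin d)) :
    ∫ ω, ‖(n : ℝ)⁻¹ • ∑ j, X (ω j) - g‖ ^ 2 ∂(Measure.pi fun _ : Fin n => q)
      ≤ M ^ 2 / n + ‖∫ ω, X ω ∂q - g‖ ^ 2 := by
  have hXL : ∀ l, MemLp (fun ω => X ω l) 2 q := fun l =>
    MemLp.of_bound (by fun_prop : Measurable _).aestronglyMeasurable M
      (hM.mono fun ω h => (PiLp.norm_apply_le (X ω) l).trans h)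
  have hXi : Integrable X q := Integrable.of_bound hX.aestronglyMeasurable M hM
  have hcoord : ∀ l, (∫ ω, X ω ∂q) l = ∫ ω, X ω l ∂q := fun l =>
    ((EuclideanSpace.proj l : EuclideanSpace ℝ (Fin d) →L[ℝ] ℝ).integral_comp_comm hXi).symm
  have hint : ∀ l, Integrable (fun ω : Fin n → Ω => ((n : ℝ)⁻¹ * ∑ j, X (ω j) l - g l) ^ 2)
      (Measure.pi fun _ => q) := fun l =>
    (((memLp_finsetSum _ fun j _ => (hXL l).comp_measurePreserving
      (measurePreserving_eval (fun _ : Fin n => q) j)).const_mul _).sub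
        (memLp_const _)).integrable_sq
  have hsq : ∑ l, ∫ ω, X ω l ^ 2 ∂q ≤ M ^ 2 := by
    rw [← integral_finsetSum _ fun l _ => (hXL l).integrable_sq]
    have h := integral_mono_ae (integrable_finsetSum _ fun l _ => (hXL l).integrable_sq)
      (integrable_const (M ^ 2)) (hM.mono fun ω h => by
        have h2 := pow_le_pow_left₀ (norm_nonneg _) h 2
        rw [EuclideanSpace.norm_sq_eq] at h2
        simpa using h2)
    simpa using h
  simp only [EuclideanSpace.norm_sq_eq, PiLp.sub_apply, PiLp.smul_apply, WithLp.ofLp_sum,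
    Finset.sum_apply, smul_eq_mul, Real.norm_eq_abs, sq_abs, hcoord]
  rw [integral_finsetSum _ fun l _ => hint l]
  calc _ ≤ ∑ l, ((∫ ω, X ω l ^ 2 ∂q) / n + (∫ ω, X ω l ∂q - g l) ^ 2) :=
        Finset.sum_le_sum fun l _ => integral_sq_average_sub_le q hn (hXL l) (g l)
    _ ≤ _ := by
        rw [Finset.sum_add_distrib, ← Finset.sum_div]
        gcongr

end Averages

/-! ### Policy gradient estimates from rollouts -/

section Estimation

variable {d : ℕ} {S A : Type*} [Fintype S] [MeasurableSpace S] [MeasurableSingletonClass S]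
  [Fintype A] [MeasurableSpace A] [MeasurableSingletonClass A]
  (P : MDP S A) (π : PolicyFamily d S A)

/-- The policy gradient estimate computed from one rollout with its advantage estimates. -/
noncomputable def rolloutGradient {T : ℕ} (γ : ℝ) (θ : Param d) (ω : Sample S A T) : Param d :=
  ∑ t : Fin T, γ ^ (t : ℕ) • ω.2 t • π.score θ (ω.1 t).1 (ω.1 t).2.1

lemma measurable_stateAction {T : ℕ} (t : Fin T) :
    Measurable fun ω : Sample S A T => ((ω.1 t).1, (ω.1 t).2.1) := by fun_prop

lemma measurable_visit {F : Type*} [MeasurableSpace F] {T : ℕ} (f : S → A → F) (t : Fin T) :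
    Measurable fun ω : Sample S A T => f (ω.1 t).1 (ω.1 t).2.1 :=
  (measurable_of_finite fun z : S × A => f z.1 z.2).comp (measurable_stateAction t)

lemma measurable_rolloutGradient {T : ℕ} (γ : ℝ) (θ : Param d) :
    Measurable (rolloutGradient π γ θ : Sample S A T → Param d) := by
  unfold rolloutGradient
  refine Finset.measurable_fun_sum _ fun t _ => ?_
  have h1 := measurable_visit (π.score θ) t
  have h2 : Measurable fun ω : Sample S A T => ω.2 t := by fun_prop
  exact (h2.smul h1).const_smul (γ ^ (t : ℕ))

variable {Pistar Astar : ℝ}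

lemma norm_rolloutGradient_le (hscore : ∀ θ s a, ‖π.score θ s a‖ ≤ Pistar) {T : ℕ} {γ : ℝ}
    (hγ : 0 ≤ γ) (θ : Param d) {ω : Sample S A T} (hω : ∀ t, |ω.2 t| ≤ Astar) :
    ‖rolloutGradient π γ θ ω‖ ≤ Pistar * Astar * ∑ t ∈ Finset.range T, γ ^ t := by
  rw [Finset.mul_sum, ← Fin.sum_univ_eq_sum_range (fun t => Pistar * Astar * γ ^ t)]
  refine norm_sum_le_of_le _ fun t _ => ?_
  rw [norm_smul, norm_smul, norm_pow, Real.norm_of_nonneg hγ, mul_comm, mul_comm Pistar]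
  exact mul_le_mul_of_nonneg_right (mul_le_mul (hω t) (hscore _ _ _) (norm_nonneg _)
    ((abs_nonneg _).trans (hω t))) (pow_nonneg hγ _)

variable {T : ℕ} (est : Estimator d S A T) [IsMarkovKernel est]

lemma memLp_condExp_sub_advantage {γ : ℝ} {θ : Param d}
    (hA : ∀ᵐ ω ∂(sampleLaw P π est θ), ∀ t, |ω.2 t| ≤ Astar) (t : Fin T) :
    MemLp (fun ω => ((sampleLaw P π est θ)[fun ω' => ω'.2 t | stateActionSigma S A t]) ω
      - advantage P π T γ θ t (ω.1 t).1 (ω.1 t).2.1) 2 (sampleLaw P π est θ) := by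
  have hm2 : Measurable fun ω : Sample S A T => ω.2 t := by fun_prop
  refine MemLp.sub ?_ ?_
  · exact (MemLp.of_bound hm2.aestronglyMeasurable Astar (hA.mono fun ω h => h t)).condExp
      (by norm_num)
  · exact (MemLp.of_discrete (μ := (sampleLaw P π est θ).map _)
      (f := fun z : S × A => advantage P π T γ θ t z.1 z.2)).comp_of_map
        (measurable_stateAction t).aemeasurable

/-- Only the conditional mean of `Â_t` given `(S_t, A_t)` enters the expectation of `Â_t` times
the score, so that the bias of the gradient estimate is controlled by that of the advantages. -/
lemma norm_integral_smul_score_sub_le (hscore : ∀ θ s a, ‖π.score θ s a‖ ≤ Pistar)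
    {γ δ : ℝ} (hδ : 0 ≤ δ) {θ : Param d}
    (hA : ∀ᵐ ω ∂(sampleLaw P π est θ), ∀ t, |ω.2 t| ≤ Astar) (t : Fin T)
    (hbias : estimatorBias P π γ est θ t ≤ δ ^ 2) :
    ‖∫ ω, ω.2 t • π.score θ (ω.1 t).1 (ω.1 t).2.1 ∂(sampleLaw P π est θ)
      - ∫ ω, advantage P π T γ θ t (ω.1 t).1 (ω.1 t).2.1 • π.score θ (ω.1 t).1 (ω.1 t).2.1
        ∂(sampleLaw P π est θ)‖ ≤ Pistar * δ := by
  set q := sampleLaw P π est θ with hq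
  set E := q[fun ω' => ω'.2 t | stateActionSigma S A t] with hE
  have hle : stateActionSigma S A t ≤ (inferInstance : MeasurableSpace (Sample S A T)) :=
    (measurable_stateAction t).comap_le
  have hm2 : Measurable fun ω : Sample S A T => ω.2 t := by fun_prop
  have hms : Measurable fun ω : Sample S A T => π.score θ (ω.1 t).1 (ω.1 t).2.1 :=
    measurable_visit (π.score θ) t
  have hAi : Integrable (fun ω : Sample S A T => ω.2 t) q :=
    Integrable.of_bound hm2.aestronglyMeasurable Astar (hA.mono fun ω h => h t)
  have hbd : ∀ᵐ ω ∂q, ‖π.score θ (ω.1 t).1 (ω.1 t).2.1‖ ≤ Pistar :=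
    ae_of_all _ fun ω => hscore _ _ _
  have hsm : StronglyMeasurable[stateActionSigma S A t]
      fun ω : Sample S A T => π.score θ (ω.1 t).1 (ω.1 t).2.1 :=
    (StronglyMeasurable.of_discrete (f := fun z : S × A => π.score θ z.1 z.2)).comp_measurable
      (comap_measurable _)
  have hi1 : Integrable ((fun ω : Sample S A T => ω.2 t)
      • fun ω => π.score θ (ω.1 t).1 (ω.1 t).2.1) q :=
    hAi.smul_bdd _ hms.aestronglyMeasurable hbd
  have hpull := condExp_smul_of_aestronglyMeasurable_right hAi hi1 hsm.aestronglyMeasurable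
  have hZ := memLp_condExp_sub_advantage P π est (γ := γ) hA t
  have hadv : Integrable (fun ω : Sample S A T =>
      advantage P π T γ θ t (ω.1 t).1 (ω.1 t).2.1 • π.score θ (ω.1 t).1 (ω.1 t).2.1) q :=
    (Integrable.of_finite (μ := q.map _) (f := fun z : S × A =>
      advantage P π T γ θ t z.1 z.2 • π.score θ z.1 z.2)).comp_measurable (measurable_stateAction t)
  have h1 : ∫ ω, ω.2 t • π.score θ (ω.1 t).1 (ω.1 t).2.1 ∂q
      = ∫ ω, E ω • π.score θ (ω.1 t).1 (ω.1 t).2.1 ∂q :=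
    (integral_condExp hle).symm.trans (integral_congr_ae hpull)
  have hEi : Integrable (fun ω => E ω • π.score θ (ω.1 t).1 (ω.1 t).2.1) q :=
    (integrable_condExp (f := fun ω : Sample S A T => ω.2 t)).smul_bdd _
      hms.aestronglyMeasurable hbd
  rw [h1, ← integral_sub hEi hadv]
  simp only [← sub_smul]
  have hZn : MemLp (fun ω => |E ω - advantage P π T γ θ t (ω.1 t).1 (ω.1 t).2.1|) 2 q := hZ.norm
  have hZ1 := abs_integral_le_of_integral_sq_le q hZn hδ (by simp only [sq_abs]; exact hbias)
  calc _ ≤ ∫ ω, Pistar * |E ω - advantage P π T γ θ t (ω.1 t).1 (ω.1 t).2.1| ∂q := by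
        refine norm_integral_le_of_norm_le ((hZn.integrable (by norm_num)).const_mul _)
          (ae_of_all _ fun ω => ?_)
        rw [norm_smul, mul_comm, Real.norm_eq_abs]
        exact mul_le_mul_of_nonneg_right (hscore _ _ _) (abs_nonneg _)
    _ ≤ Pistar * δ := by
        rw [integral_const_mul]
        have ω := (nonempty_of_isProbabilityMeasure q).some
        exact mul_le_mul_of_nonneg_left ((le_abs_self _).trans hZ1)
          ((norm_nonneg _).trans (hscore θ (ω.1 t).1 (ω.1 t).2.1))

lemma norm_integral_rolloutGradient_sub_le {Rstar : ℝ}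
    (hR : ∀ s a, ∀ᵐ x ∂(P.step (s, a)), |x.1| ≤ Rstar)
    (hscore : ∀ θ s a, ‖π.score θ s a‖ ≤ Pistar)
    {γ δ : ℝ} (hγ : 0 ≤ γ) (hγ1 : γ ≤ 1) (hδ : 0 ≤ δ) {θ : Param d}
    (hA : ∀ᵐ ω ∂(sampleLaw P π est θ), ∀ t, |ω.2 t| ≤ Astar)
    (hbias : ∀ t, estimatorBias P π γ est θ t ≤ δ ^ 2) :
    ‖∫ ω, rolloutGradient π γ θ ω ∂(sampleLaw P π est θ) - gradient (objective P π T γ) θ‖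
      ≤ T * Pistar * δ := by
  have hi : ∀ t : Fin T, Integrable (fun ω : Sample S A T =>
      γ ^ (t : ℕ) • ω.2 t • π.score θ (ω.1 t).1 (ω.1 t).2.1) (sampleLaw P π est θ) := fun t => by
    have hm2 : Measurable fun ω : Sample S A T => ω.2 t := by fun_prop
    exact ((Integrable.of_bound hm2.aestronglyMeasurable Astar (hA.mono fun ω h => h t)).smul_bdd _
      (measurable_visit (π.score θ) t).aestronglyMeasurable
      (ae_of_all _ fun ω => hscore _ _ _)).smul (γ ^ (t : ℕ))
  rw [gradient_objective_eq_sum_integral P π hR γ est]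
  simp only [rolloutGradient]
  rw [integral_finsetSum _ fun t _ => hi t, ← Finset.sum_sub_distrib]
  calc _ ≤ ∑ _t : Fin T, Pistar * δ := norm_sum_le_of_le _ fun t _ => by
        rw [integral_smul, ← smul_sub, norm_smul, norm_pow, Real.norm_of_nonneg hγ]
        exact (mul_le_of_le_one_left (norm_nonneg _) (pow_le_one₀ hγ hγ1)).trans
          (norm_integral_smul_score_sub_le P π est hscore hδ hA t (hbias t))
    _ = _ := by simp [mul_assoc]

end Estimation

/-! ### Inexact gradient ascent -/

section Ascent

variable {E : Type*} [NormedAddCommGroup E] [InnerProductSpace ℝ E] [CompleteSpace E]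

/-- Quadratic lower bound for a function with Lipschitz gradient. -/
lemma add_inner_sub_le_of_lipschitz_gradient {f : E → ℝ} (hf : Differentiable ℝ f) {L : ℝ}
    (hL : ∀ x y, ‖gradient f x - gradient f y‖ ≤ L * ‖x - y‖) (x v : E) :
    f x + inner ℝ (gradient f x) v - L / 2 * ‖v‖ ^ 2 ≤ f (x + v) := by
  set φ : ℝ → ℝ := fun τ => f (x + τ • v) - τ * inner ℝ (gradient f x) v + L / 2 * ‖v‖ ^ 2 * τ ^ 2
    with hφ
  have hd : ∀ τ, HasDerivAt φ (inner ℝ (gradient f (x + τ • v)) v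
      - inner ℝ (gradient f x) v + L * ‖v‖ ^ 2 * τ) τ := fun τ => by
    have h1 : HasDerivAt (fun τ : ℝ => x + τ • v) v τ := by
      simpa using ((hasDerivAt_id τ).smul_const v).const_add x
    have h2 := (hf (x + τ • v)).hasGradientAt.hasFDerivAt.comp_hasDerivAt τ h1
    rw [InnerProductSpace.toDual_apply_apply] at h2
    have h3 := (h2.sub ((hasDerivAt_id τ).mul_const (inner ℝ (gradient f x) v))).add
      ((hasDerivAt_pow 2 τ).const_mul (L / 2 * ‖v‖ ^ 2))
    refine h3.congr_deriv ?_
    simp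
    ring
  have hmono : MonotoneOn φ (Set.Icc 0 1) := by
    refine monotoneOn_of_deriv_nonneg (convex_Icc 0 1)
      (fun τ _ => (hd τ).continuousAt.continuousWithinAt)
      (fun τ _ => (hd τ).differentiableAt.differentiableWithinAt) fun τ hτ => ?_
    rw [interior_Icc] at hτ
    rw [(hd τ).deriv, ← inner_sub_left]
    have h1 := neg_le_of_abs_le (abs_real_inner_le_norm (gradient f (x + τ • v) - gradient f x) v)
    have h2 := hL (x + τ • v) x
    rw [add_sub_cancel_left, norm_smul, Real.norm_of_nonneg hτ.1.le] at h2
    nlinarith [mul_le_mul_of_nonneg_right h2 (norm_nonneg v)]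
  have h := hmono (Set.left_mem_Icc.2 zero_le_one) (Set.right_mem_Icc.2 zero_le_one) zero_le_one
  simp only [hφ, zero_smul, add_zero, one_smul] at h
  linarith

/-- Progress of one inexact ascent step `x ↦ x + h • u` with `L h ≤ 1`. -/
lemma ascent_step {f : E → ℝ} (hf : Differentiable ℝ f) {L h : ℝ}
    (hL : ∀ x y, ‖gradient f x - gradient f y‖ ≤ L * ‖x - y‖) (hh : 0 ≤ h) (hLh : L * h ≤ 1)
    (x u : E) :
    f x + h / 2 * (‖gradient f x‖ ^ 2 - ‖gradient f x - u‖ ^ 2) ≤ f (x + h • u) := by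
  have h1 := add_inner_sub_le_of_lipschitz_gradient hf hL x (h • u)
  rw [real_inner_smul_right, norm_smul, Real.norm_of_nonneg hh] at h1
  have h2 := norm_sub_sq_real (gradient f x) u
  nlinarith [mul_nonneg hh (mul_nonneg (sub_nonneg.2 hLh) (sq_nonneg ‖u‖))]

/-- An inexact ascent step whose direction `u` is compared with the gradient at another point `y`
through an estimate `g` of that gradient. -/
lemma norm_gradient_sq_le_of_ascent {f : E → ℝ} (hf : Differentiable ℝ f) {L h : ℝ}
    (hL : ∀ x y, ‖gradient f x - gradient f y‖ ≤ L * ‖x - y‖) (hh : 0 < h) (hLh : L * h ≤ 1)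
    {x y u g : E} {D M : ℝ} (hD : ‖gradient f x - gradient f y‖ ≤ D) (hM : ‖g - u‖ ≤ M) :
    ‖gradient f x‖ ^ 2 ≤ 2 / h * (f (x + h • u) - f x)
      + (3 * ‖g - gradient f y‖ ^ 2 + 3 * D ^ 2 + 3 * M ^ 2) := by
  have hasc := ascent_step hf hL hh.le hLh x u
  have herr : ‖gradient f x - u‖ ≤ D + ‖g - gradient f y‖ + M := by
    have hsplit : gradient f x - u
        = (gradient f x - gradient f y) - (g - gradient f y) + (g - u) := by abel
    rw [hsplit]
    exact (norm_add_le _ _).trans (add_le_add ((norm_sub_le _ _).trans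
      (add_le_add hD le_rfl)) hM)
  have hsq : ‖gradient f x - u‖ ^ 2 ≤ 3 * ‖g - gradient f y‖ ^ 2 + 3 * D ^ 2 + 3 * M ^ 2 := by
    refine (pow_le_pow_left₀ (norm_nonneg _) herr 2).trans ?_
    nlinarith [sq_nonneg (D - ‖g - gradient f y‖), sq_nonneg (D - M),
      sq_nonneg (‖g - gradient f y‖ - M)]
  have hdiv : ‖gradient f x‖ ^ 2 - ‖gradient f x - u‖ ^ 2 ≤ 2 / h * (f (x + h • u) - f x) := by
    rw [div_mul_eq_mul_div, le_div_iff₀ hh]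
    linarith
  linarith

end Ascent

/-! ### Minibatches -/

section Minibatches

lemma card_minibatch_le {N : ℕ} (B : ℕ) (σ : Equiv.Perm (Fin N)) (k : ℕ) :
    (minibatch B σ k).card ≤ B := by
  refine Finset.card_image_le.trans ?_
  rw [← Finset.card_map Fin.valEmbedding]
  have hsub : (Finset.univ.filter fun j : Fin N => k * B ≤ (j : ℕ) ∧ (j : ℕ) < (k + 1) * B).map
      Fin.valEmbedding ⊆ Finset.Ico (k * B) ((k + 1) * B) := fun j hj => by
    simp only [Finset.mem_map, Finset.mem_filter, Finset.mem_univ, true_and] at hj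
    obtain ⟨i, hi, rfl⟩ := hj
    exact Finset.mem_Ico.2 hi
  refine (Finset.card_le_card hsub).trans (le_of_eq ?_)
  rw [Nat.card_Ico, add_mul, one_mul, Nat.add_sub_cancel_left]

/-- The minibatches of an epoch partition the buffer. -/
lemma sum_sum_minibatch {N m B : ℕ} (hB : 0 < B) (hN : N = m * B) (σ : Equiv.Perm (Fin N))
    {E : Type*} [AddCommMonoid E] (f : Fin N → E) :
    ∑ k ∈ Finset.range m, ∑ i ∈ minibatch B σ k, f i = ∑ i, f i := by
  rw [← Equiv.sum_comp σ f, ← Finset.sum_fiberwise_of_maps_to (s := Finset.univ)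
    (t := Finset.range m) (g := fun j : Fin N => (j : ℕ) / B) fun j _ => Finset.mem_range.2
      ((Nat.div_lt_iff_lt_mul hB).2 (hN ▸ j.2))]
  refine Finset.sum_congr rfl fun k _ => ?_
  rw [minibatch, Finset.sum_image fun i _ j _ h => σ.injective h]
  refine Finset.sum_congr (Finset.filter_congr fun j _ => ?_) fun _ _ => rfl
  rw [Nat.div_eq_iff hB, add_mul]
  omega

lemma norm_inv_smul_sum_le {E ι : Type*} [NormedAddCommGroup E] [NormedSpace ℝ E] {I : Finset ι}
    {B : ℕ} (hB : 0 < B) (hI : I.card ≤ B) {f : ι → E} {M : ℝ} (hM : 0 ≤ M)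
    (hf : ∀ i ∈ I, ‖f i‖ ≤ M) : ‖(B : ℝ)⁻¹ • ∑ i ∈ I, f i‖ ≤ M := by
  have hB' : (0 : ℝ) < B := by exact_mod_cast hB
  rw [norm_smul, norm_inv, Real.norm_natCast, inv_mul_le_iff₀ hB']
  refine (norm_sum_le_of_le _ hf).trans ?_
  rw [Finset.sum_const, nsmul_eq_mul]
  exact mul_le_mul_of_nonneg_right (by exact_mod_cast hI) hM

end Minibatches

/-! ### Clipped contributions -/

section Clipping

variable {d : ℕ} {S A : Type*} [Fintype A] (π : PolicyFamily d S A)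
  {Pistar Ls Astar γ ε : ℝ}

lemma clippedContribution_eq (T : ℕ) (γ ε : ℝ) (θ θold : Param d) (t : ℕ) (s : S) (a : A)
    (adv : ℝ) : clippedContribution π T γ ε θ θold t s a adv = (T * γ ^ t * adv) •
      (π.prob θ s a / π.prob θold s a *
        if |π.prob θ s a / π.prob θold s a - 1| ≤ ε then 1 else 0) • π.score θ s a := by
  rw [clippedContribution, (hasGradientAt_prob π θ s a).gradient]
  simp only [smul_smul]
  congr 1
  ring

lemma clippedContribution_self (hε : 0 ≤ ε) (T : ℕ) (γ : ℝ) (θ : Param d) (t : ℕ) (s : S) (a : A)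
    (adv : ℝ) : clippedContribution π T γ ε θ θ t s a adv = (T * γ ^ t * adv) • π.score θ s a := by
  rw [clippedContribution_eq, div_self (π.prob_pos θ s a).ne']
  simp [hε]

lemma abs_mul_pow_mul_le (hγ : 0 ≤ γ) (hγ1 : γ ≤ 1) (T t : ℕ) {adv : ℝ} (hadv : |adv| ≤ Astar) :
    |T * γ ^ t * adv| ≤ T * Astar := by
  rw [abs_mul, abs_mul, Nat.abs_cast, abs_of_nonneg (pow_nonneg hγ t)]
  refine mul_le_mul ?_ hadv (abs_nonneg _) (Nat.cast_nonneg T)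
  exact mul_le_of_le_one_right (Nat.cast_nonneg T) (pow_le_one₀ hγ hγ1)

lemma norm_clippedContribution_le (hscore : ∀ θ s a, ‖π.score θ s a‖ ≤ Pistar) (hγ : 0 ≤ γ)
    (hγ1 : γ ≤ 1) (hε : 0 ≤ ε) (T : ℕ) (θ θold : Param d) (t : ℕ) (s : S) (a : A) {adv : ℝ}
    (hadv : |adv| ≤ Astar) :
    ‖clippedContribution π T γ ε θ θold t s a adv‖ ≤ T * (1 + ε) * Pistar * Astar := by
  have hA : 0 ≤ Astar := (abs_nonneg _).trans hadv
  rw [clippedContribution_eq, norm_smul, norm_smul, Real.norm_eq_abs, Real.norm_eq_abs]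
  have h1 := abs_mul_pow_mul_le hγ hγ1 T t hadv
  have h2 : |π.prob θ s a / π.prob θold s a *
      if |π.prob θ s a / π.prob θold s a - 1| ≤ ε then (1 : ℝ) else 0| ≤ 1 + ε := by
    have h0 := div_pos (π.prob_pos θ s a) (π.prob_pos θold s a)
    split_ifs with h
    · rw [mul_one, abs_of_pos h0]
      linarith [(abs_le.1 h).2]
    · simpa using by linarith
  calc _ ≤ (T * Astar) * ((1 + ε) * Pistar) := by
        refine mul_le_mul h1 (mul_le_mul h2 (hscore θ s a) (norm_nonneg _) (by linarith))
          (by positivity) (by positivity)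
    _ = _ := by ring

/-- A local estimate of the clipped likelihood ratio: where the clip is inactive the deviation is
at most `min ε (2 w)`, and it can be active only if `ε < 2 w`. -/
lemma sq_one_sub_clipped_ratio_le (hscore : ∀ θ s a, ‖π.score θ s a‖ ≤ Pistar) (hε : 0 < ε)
    {w : ℝ} (hw0 : 0 ≤ w) (hw : w ≤ 1) {θ θold : Param d} (h : Pistar * ‖θ - θold‖ ≤ w)
    (s : S) (a : A) {p q : ℝ} (hp0 : 0 < p) (hp1 : p < 1) (hq0 : 0 < q) (hq1 : q < 1) :
    (1 - π.prob θ s a / π.prob θold s a *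
      if |π.prob θ s a / π.prob θold s a - 1| ≤ ε then (1 : ℝ) else 0) ^ 2
      ≤ 7 * (ε ^ (2 * (1 - p)) * w ^ (2 * p) + (w / ε) ^ q) := by
  set r := π.prob θ s a / π.prob θold s a with hr
  have hr2 : |r - 1| ≤ 2 * w := abs_prob_div_sub_one_le π hscore hw θ θold s a h
  split_ifs with hc
  · have h1 : |r - 1| ≤ ε ^ (1 - p) * (2 * w) ^ p := by
      rcases (abs_nonneg (r - 1)).eq_or_lt with h0 | h0
      · rw [← h0]; positivity
      calc |r - 1| = |r - 1| ^ (1 - p) * |r - 1| ^ p := by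
            rw [← Real.rpow_add h0, sub_add_cancel, Real.rpow_one]
        _ ≤ _ := mul_le_mul (Real.rpow_le_rpow h0.le hc (by linarith))
              (Real.rpow_le_rpow h0.le hr2 hp0.le) (by positivity) (by positivity)
    have h2 : (2 : ℝ) ^ (2 * p) ≤ 4 := by
      calc (2 : ℝ) ^ (2 * p) ≤ 2 ^ (2 : ℝ) :=
            Real.rpow_le_rpow_of_exponent_le (by norm_num) (by linarith)
        _ = 4 := by norm_num
    have h3 : (ε ^ (1 - p) * (2 * w) ^ p) ^ 2
        = 2 ^ (2 * p) * (ε ^ (2 * (1 - p)) * w ^ (2 * p)) := by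
      rw [mul_pow, ← Real.rpow_natCast, ← Real.rpow_natCast, ← Real.rpow_mul hε.le,
        ← Real.rpow_mul (by positivity), Real.mul_rpow (by norm_num) hw0]
      push_cast
      rw [mul_comm (1 - p), mul_comm p]
      ring
    have h4 : (1 - r * 1) ^ 2 ≤ (ε ^ (1 - p) * (2 * w) ^ p) ^ 2 := by
      rw [mul_one, ← sq_abs, abs_sub_comm]
      exact pow_le_pow_left₀ (abs_nonneg _) h1 2
    have h5 : 0 ≤ ε ^ (2 * (1 - p)) * w ^ (2 * p) := by positivity
    have h6 : 0 ≤ (w / ε) ^ q := by positivity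
    rw [h3] at h4
    nlinarith
  · have h1 : 1 / 2 ≤ w / ε := by
      rw [div_le_div_iff₀ (by norm_num) hε]
      linarith [not_le.1 hc]
    have h2 : (1 / 2 : ℝ) ≤ (w / ε) ^ q := by
      calc (1 / 2 : ℝ) = (1 / 2) ^ (1 : ℝ) := by simp
        _ ≤ (1 / 2) ^ q := Real.rpow_le_rpow_of_exponent_ge (by norm_num) (by norm_num) hq1.le
        _ ≤ _ := Real.rpow_le_rpow (by norm_num) h1 hq0.le
    have h5 : 0 ≤ ε ^ (2 * (1 - p)) * w ^ (2 * p) := by positivity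
    norm_num
    linarith

lemma norm_clippedContribution_sub_self_le (hscore : ∀ θ s a, ‖π.score θ s a‖ ≤ Pistar)
    (hscoreLip : ∀ θ θ' s a, ‖π.score θ s a - π.score θ' s a‖ ≤ Ls * ‖θ - θ'‖)
    (hγ : 0 ≤ γ) (hγ1 : γ ≤ 1) (hε : 0 ≤ ε) (T : ℕ) (θ θold : Param d) (t : ℕ) (s : S) (a : A)
    {adv V : ℝ} (hadv : |adv| ≤ Astar)
    (hV : (1 - π.prob θ s a / π.prob θold s a *
      if |π.prob θ s a / π.prob θold s a - 1| ≤ ε then (1 : ℝ) else 0) ^ 2 ≤ V) :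
    ‖clippedContribution π T γ ε θold θold t s a adv - clippedContribution π T γ ε θ θold t s a adv‖
      ≤ T * Astar * (Ls * ‖θ - θold‖) + T * Astar * Pistar * √V := by
  rw [clippedContribution_self π hε, clippedContribution_eq, ← smul_sub]
  set c := π.prob θ s a / π.prob θold s a *
      if |π.prob θ s a / π.prob θold s a - 1| ≤ ε then (1 : ℝ) else 0 with hc
  have hA : 0 ≤ Astar := (abs_nonneg _).trans hadv
  have h1 : π.score θold s a - c • π.score θ s a
      = (π.score θold s a - π.score θ s a) + (1 - c) • π.score θ s a := by
    rw [sub_smul, one_smul]; abel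
  have h2 : ‖π.score θold s a - c • π.score θ s a‖ ≤ Ls * ‖θ - θold‖ + √V * Pistar := by
    rw [h1]
    refine (norm_add_le _ _).trans (add_le_add ?_ ?_)
    · rw [norm_sub_rev]; exact hscoreLip θ θold s a
    · rw [norm_smul]
      exact mul_le_mul (Real.abs_le_sqrt hV) (hscore θ s a) (norm_nonneg _) (Real.sqrt_nonneg V)
  rw [norm_smul]
  calc _ ≤ T * Astar * (Ls * ‖θ - θold‖ + √V * Pistar) :=
        mul_le_mul (abs_mul_pow_mul_le hγ hγ1 T t hadv) h2 (norm_nonneg _) (by positivity)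
    _ = _ := by ring

end Clipping

/-! ### Pathwise progress of a cycle -/

section Cycle

variable {d : ℕ} {S A : Type*} [Fintype A] (π : PolicyFamily d S A)
  {n T K B m : ℕ} {Pistar Ls Astar γ ε η G : ℝ}

lemma norm_minibatchGradient_le (hB : 0 < B) (hG0 : 0 ≤ G) {data : Fin n → Sample S A T}
    {θold : Param d} (hG : ∀ θ i, ‖bufferContribution π γ ε data θ θold i‖ ≤ G) (θ : Param d)
    (σ : Equiv.Perm (Fin (n * T))) (k : ℕ) :
    ‖minibatchGradient π γ ε B data θ θold (minibatch B σ k)‖ ≤ G :=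
  norm_inv_smul_sum_le hB (card_minibatch_le B σ k) hG0 fun i _ => hG θ i

lemma epochParam_eq (data : Fin n → Sample S A T) (θold : Param d)
    (σ : Equiv.Perm (Fin (n * T))) (θ : Param d) (k : ℕ) :
    epochParam π γ ε η B data θold σ θ k = θ + η • ∑ j ∈ Finset.range k,
      minibatchGradient π γ ε B data (epochParam π γ ε η B data θold σ θ j) θold
        (minibatch B σ j) := by
  induction k with
  | zero => simp [epochParam]
  | succ k ih =>
    rw [Finset.sum_range_succ, smul_add, ← add_assoc, ← ih]
    rfl

lemma norm_epochParam_sub_le (hB : 0 < B) (hη : 0 ≤ η) (hG0 : 0 ≤ G) {data : Fin n → Sample S A T}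
    {θold : Param d} (hG : ∀ θ i, ‖bufferContribution π γ ε data θ θold i‖ ≤ G)
    (σ : Equiv.Perm (Fin (n * T))) (θ : Param d) (k : ℕ) :
    ‖epochParam π γ ε η B data θold σ θ k - θ‖ ≤ k * (η * G) := by
  rw [epochParam_eq, add_sub_cancel_left, norm_smul, Real.norm_of_nonneg hη, mul_left_comm]
  refine mul_le_mul_of_nonneg_left ((norm_sum_le_of_le _ fun j _ =>
    norm_minibatchGradient_le π hB hG0 hG _ σ j).trans ?_) hη
  simp

@[simp] lemma cycleParam_zero (D : CycleData S A n T K) (θold : Param d) :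
    cycleParam π γ ε η B m D θold 0 = θold := rfl

lemma cycleParam_succ (D : CycleData S A n T K) (θold : Param d) (e : Fin K) :
    cycleParam π γ ε η B m D θold e.succ = epochParam π γ ε η B D.1 θold (D.2 e)
      (cycleParam π γ ε η B m D θold e.castSucc) m := by
  simp [cycleParam]

lemma norm_cycleParam_sub_le (hB : 0 < B) (hη : 0 ≤ η) (hG0 : 0 ≤ G) {D : CycleData S A n T K}
    {θold : Param d} (hG : ∀ θ i, ‖bufferContribution π γ ε D.1 θ θold i‖ ≤ G)
    (e : Fin (K + 1)) :
    ‖cycleParam π γ ε η B m D θold e - θold‖ ≤ e * m * (η * G) := by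
  induction e using Fin.induction with
  | zero => simp
  | succ e ih =>
    have h := norm_epochParam_sub_le π hB hη hG0 hG (D.2 e)
      (cycleParam π γ ε η B m D θold e.castSucc) m
    rw [← cycleParam_succ] at h
    refine (norm_sub_le_norm_sub_add_norm_sub _ _ _).trans ((add_le_add h ih).trans (le_of_eq ?_))
    simp only [Fin.val_succ, Fin.val_castSucc]
    push_cast
    ring

/-- All parameters used within a cycle stay within distance `K m η G` of its initial parameter. -/
lemma norm_epochParam_cycleParam_sub_le (hB : 0 < B) (hη : 0 ≤ η) (hG0 : 0 ≤ G)
    {D : CycleData S A n T K} {θold : Param d}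
    (hG : ∀ θ i, ‖bufferContribution π γ ε D.1 θ θold i‖ ≤ G) (e : Fin K) {k : ℕ} (hk : k ≤ m) :
    ‖epochParam π γ ε η B D.1 θold (D.2 e) (cycleParam π γ ε η B m D θold e.castSucc) k - θold‖
      ≤ η * K * m * G := by
  have h1 := norm_epochParam_sub_le π hB hη hG0 hG (D.2 e)
    (cycleParam π γ ε η B m D θold e.castSucc) k
  have h2 := norm_cycleParam_sub_le π hB hη hG0 hG (m := m) e.castSucc
  have h3 : (k : ℝ) * (η * G) ≤ m * (η * G) := by gcongr
  have h4 : ((e : ℕ) : ℝ) + 1 ≤ K := by exact_mod_cast e.2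
  refine (norm_sub_le_norm_sub_add_norm_sub _ _ _).trans ((add_le_add (h1.trans h3) h2).trans ?_)
  rw [Fin.val_castSucc]
  calc _ = ((e : ℕ) + 1) * (m * (η * G)) := by ring
    _ ≤ K * (m * (η * G)) := by gcongr
    _ = _ := by ring

/-- At the sampling parameter clipping is inactive, and the buffer average is the average of the
policy gradient estimates of the `n` rollouts. -/
lemma sum_bufferContribution_self (hε : 0 ≤ ε) (data : Fin n → Sample S A T) (θ : Param d) :
    ∑ i, bufferContribution π γ ε data θ θ i = (T : ℝ) • ∑ j, rolloutGradient π γ θ (data j) := by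
  rw [← Equiv.sum_comp finProdFinEquiv, Fintype.sum_prod_type, Finset.smul_sum]
  refine Finset.sum_congr rfl fun j _ => ?_
  rw [rolloutGradient, Finset.smul_sum]
  refine Finset.sum_congr rfl fun t _ => ?_
  simp only [bufferContribution, Equiv.symm_apply_apply]
  rw [clippedContribution_self π hε, smul_smul, smul_smul, mul_assoc]

/-- The mean update direction of an epoch deviates from the gradient estimate at the sampling
parameter by at most the largest change of a single contribution. -/
lemma norm_average_sub_epoch_le (hB : 0 < B) (hn : 0 < n) (hm : 0 < m)
    (hN : n * T = m * B) (hε : 0 ≤ ε) {data : Fin n → Sample S A T} {θold θ : Param d}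
    (σ : Equiv.Perm (Fin (n * T))) {M : ℝ} (hM0 : 0 ≤ M)
    (hM : ∀ k ≤ m, ∀ i, ‖bufferContribution π γ ε data θold θold i
      - bufferContribution π γ ε data (epochParam π γ ε η B data θold σ θ k) θold i‖ ≤ M) :
    ‖(n : ℝ)⁻¹ • ∑ j, rolloutGradient π γ θold (data j) - (m : ℝ)⁻¹ • ∑ k ∈ Finset.range m,
      minibatchGradient π γ ε B data (epochParam π γ ε η B data θold σ θ k) θold
        (minibatch B σ k)‖ ≤ M := by
  have hnum : (n : ℝ)⁻¹ = (m : ℝ)⁻¹ * (B : ℝ)⁻¹ * T := by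
    have h : (n : ℝ) * T = m * B := by exact_mod_cast hN
    field_simp
    linarith
  have h1 : (n : ℝ)⁻¹ • ∑ j, rolloutGradient π γ θold (data j)
      = (m : ℝ)⁻¹ • ∑ k ∈ Finset.range m,
        (B : ℝ)⁻¹ • ∑ i ∈ minibatch B σ k, bufferContribution π γ ε data θold θold i := by
    rw [← Finset.smul_sum, sum_sum_minibatch hB hN, sum_bufferContribution_self π hε, smul_smul,
      smul_smul, hnum]
  rw [h1, ← smul_sub, ← Finset.sum_sub_distrib]
  refine norm_inv_smul_sum_le hm (Finset.card_range m).le hM0 fun k hk => ?_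
  rw [minibatchGradient, ← smul_sub, ← Finset.sum_sub_distrib]
  exact norm_inv_smul_sum_le hB (card_minibatch_le B σ k) hM0 fun i _ =>
    hM k (Finset.mem_range.1 hk).le i

/-- Progress of one cycle, for fixed data: each epoch is an inexact ascent step of length `η m`.
The error consists of the drift of the true gradient, the estimation error at the sampling
parameter, and the change of the clipped surrogate gradient (bounded by `M`). -/
lemma sum_norm_gradient_sq_le {J : Param d → ℝ} (hJ : Differentiable ℝ J) {L : ℝ} (hL0 : 0 ≤ L)
    (hL : ∀ θ θ', ‖gradient J θ - gradient J θ'‖ ≤ L * ‖θ - θ'‖)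
    (hB : 0 < B) (hn : 0 < n) (hm : 0 < m) (hN : n * T = m * B) (hε : 0 ≤ ε)
    (hη : 0 < η) (hηL : L * (η * m) ≤ 1) (hG0 : 0 ≤ G) {D : CycleData S A n T K} {θold : Param d}
    (hG : ∀ θ i, ‖bufferContribution π γ ε D.1 θ θold i‖ ≤ G) {M : ℝ} (hM0 : 0 ≤ M)
    (hM : ∀ θ, ‖θ - θold‖ ≤ η * K * m * G → ∀ i, ‖bufferContribution π γ ε D.1 θold θold i
      - bufferContribution π γ ε D.1 θ θold i‖ ≤ M) :
    ∑ e : Fin K, ‖gradient J (cycleParam π γ ε η B m D θold e.castSucc)‖ ^ 2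
      ≤ 2 / (η * m) * (J (cycleParam π γ ε η B m D θold (Fin.last K)) - J θold)
        + K * (3 * ‖(n : ℝ)⁻¹ • ∑ j, rolloutGradient π γ θold (D.1 j) - gradient J θold‖ ^ 2
          + 3 * (L * (η * K * m * G)) ^ 2 + 3 * M ^ 2) := by
  have hm' : (0 : ℝ) < m := by exact_mod_cast hm
  have hηm : 0 < η * m := by positivity
  have hstep : ∀ e : Fin K, ‖gradient J (cycleParam π γ ε η B m D θold e.castSucc)‖ ^ 2
      ≤ 2 / (η * m) * (J (cycleParam π γ ε η B m D θold e.succ)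
          - J (cycleParam π γ ε η B m D θold e.castSucc))
        + (3 * ‖(n : ℝ)⁻¹ • ∑ j, rolloutGradient π γ θold (D.1 j) - gradient J θold‖ ^ 2
          + 3 * (L * (η * K * m * G)) ^ 2 + 3 * M ^ 2) := by
    intro e
    have hdrift : ‖gradient J (cycleParam π γ ε η B m D θold e.castSucc) - gradient J θold‖
        ≤ L * (η * K * m * G) := by
      have h0 := norm_epochParam_cycleParam_sub_le π hB hη.le hG0 hG e (Nat.zero_le m)
      rw [epochParam] at h0
      exact (hL _ _).trans (mul_le_mul_of_nonneg_left h0 hL0)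
    have hsurr := norm_average_sub_epoch_le π (η := η) hB hn hm hN hε (D.2 e)
      (data := D.1) (θold := θold) (θ := cycleParam π γ ε η B m D θold e.castSucc) hM0
      fun k hk => hM _ (norm_epochParam_cycleParam_sub_le π hB hη.le hG0 hG e hk)
    have h := norm_gradient_sq_le_of_ascent hJ hL hηm hηL hdrift hsurr
    rwa [smul_smul, mul_assoc η, mul_inv_cancel₀ hm'.ne', mul_one, ← epochParam_eq,
      ← cycleParam_succ] at h
  have htel : ∑ e : Fin K, (J (cycleParam π γ ε η B m D θold e.succ)
      - J (cycleParam π γ ε η B m D θold e.castSucc))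
      = J (cycleParam π γ ε η B m D θold (Fin.last K)) - J θold := by
    have h1 := Fin.sum_univ_succ fun e => J (cycleParam π γ ε η B m D θold e)
    rw [Fin.sum_univ_castSucc, cycleParam_zero] at h1
    rw [Finset.sum_sub_distrib]
    linarith
  refine (Finset.sum_le_sum fun e _ => hstep e).trans (le_of_eq ?_)
  rw [Finset.sum_add_distrib, ← Finset.mul_sum, htel]
  simp only [Finset.sum_const, Finset.card_univ, Fintype.card_fin, nsmul_eq_mul]

end Cycle

/-! ### Drift along a controlled chain -/

section ChainPotential

variable {X Y : Type*} [MeasurableSpace X] [MeasurableSpace Y]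

/-- The states of a controlled chain that starts at `x` and has the observations `ω`. -/
def chainState (next : X × Y → X) {C : ℕ} (x : X) (ω : Fin C → Y) : Fin (C + 1) → X :=
  Fin.induction x fun c z => next (z, ω c)

lemma chainState_cons (next : X × Y → X) {C : ℕ} (x : X) (y : Y) (ω : Fin C → Y)
    (c : Fin (C + 1)) : chainState next x (Fin.cons y ω : Fin (C + 1) → Y) c.succ
      = chainState next (next (x, y)) ω c := by
  induction c using Fin.induction with
  | zero => rfl
  | succ c ih =>
    have h1 : chainState next x (Fin.cons y ω : Fin (C + 1) → Y) c.succ.succ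
        = next (chainState next x (Fin.cons y ω : Fin (C + 1) → Y) c.succ.castSucc,
          (Fin.cons y ω : Fin (C + 1) → Y) c.succ) := by simp only [chainState, Fin.induction_succ]
    have h2 : chainState next (next (x, y)) ω c.succ
        = next (chainState next (next (x, y)) ω c.castSucc, ω c) := by
      simp only [chainState, Fin.induction_succ]
    rw [h1, h2, Fin.cons_succ, ← ih]
    rfl

lemma measurable_chainState {next : X × Y → X} (hnext : Measurable next) {C : ℕ} (x : X)
    (c : Fin (C + 1)) : Measurable fun ω : Fin C → Y => chainState next x ω c := by
  induction c using Fin.induction with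
  | zero => exact measurable_const
  | succ c ih =>
    simp only [chainState, Fin.induction_succ]
    exact hnext.comp (ih.prodMk (measurable_pi_apply c))

/-- Drift argument for a controlled chain: if the expected cost of a step is bounded by a multiple
of the expected increase of a potential `Φ ≤ Φmax` plus a constant, the total cost is bounded by
the largest possible increase of the potential plus the accumulated constants. -/
lemma integral_chain_sum_le {κ : Kernel X Y} [IsMarkovKernel κ] {next : X × Y → X}
    (hnext : Measurable next) {f : X × Y → ℝ} (hf : Measurable f) {M : ℝ} (hfM : ∀ z, |f z| ≤ M)
    {Φ : X → ℝ} (hΦ : Measurable Φ) {M' Φmax : ℝ} (hΦM : ∀ x, |Φ x| ≤ M')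
    (hΦmax : ∀ x, Φ x ≤ Φmax) {a b : ℝ} (ha : 0 ≤ a)
    (hstep : ∀ x, ∫ y, f (x, y) ∂(κ x) ≤ a * (∫ y, Φ (next (x, y)) ∂(κ x) - Φ x) + b)
    (C : ℕ) (x : X) :
    ∫ ω, ∑ c : Fin C, f (chainState next x ω c.castSucc, ω c) ∂(chain κ next hnext C x)
      ≤ a * (Φmax - Φ x) + C * b := by
  have hint : ∀ (C : ℕ) (x : X), Integrable
      (fun ω => ∑ c : Fin C, f (chainState next x ω c.castSucc, ω c)) (chain κ next hnext C x) :=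
    fun C x => integrable_finsetSum _ fun c _ => Integrable.of_bound
      (hf.comp ((measurable_chainState hnext x c.castSucc).prodMk
        (measurable_pi_apply c))).aestronglyMeasurable M (ae_of_all _ fun ω => hfM _)
  induction C generalizing x with
  | zero => simpa using mul_nonneg ha (sub_nonneg.2 (hΦmax x))
  | succ C ih =>
    have hfi : Integrable (fun y => f (x, y)) (κ x) := Integrable.of_bound
      (hf.comp measurable_prodMk_left).aestronglyMeasurable M (ae_of_all _ fun ω => hfM _)
    have hΦi : Integrable (fun y => Φ (next (x, y))) (κ x) := Integrable.of_bound
      (hΦ.comp (hnext.comp measurable_prodMk_left)).aestronglyMeasurable M'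
      (ae_of_all _ fun ω => hΦM _)
    rw [integral_chain_succ hnext (hint (C + 1) x)]
    have hinner : ∀ y, ∫ ω, ∑ c : Fin (C + 1), f (chainState next x (Fin.cons y ω) c.castSucc,
        (Fin.cons y ω : Fin (C + 1) → Y) c) ∂(chain κ next hnext C (next (x, y)))
        ≤ f (x, y) + (a * (Φmax - Φ (next (x, y))) + C * b) := fun y => by
      have h : ∀ ω : Fin C → Y, ∑ c : Fin (C + 1), f (chainState next x (Fin.cons y ω) c.castSucc,
          (Fin.cons y ω : Fin (C + 1) → Y) c)
          = f (x, y) + ∑ c : Fin C, f (chainState next (next (x, y)) ω c.castSucc, ω c) :=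
          fun ω => by
        rw [Fin.sum_univ_succ]
        congr 1
        refine Finset.sum_congr rfl fun c _ => ?_
        rw [← Fin.succ_castSucc, chainState_cons, Fin.cons_succ]
      simp only [h]
      rw [integral_add (integrable_const _) (hint C _)]
      simpa using ih (next (x, y))
    have hmono : ∫ y, ∫ ω, ∑ c : Fin (C + 1), f (chainState next x (Fin.cons y ω) c.castSucc,
        (Fin.cons y ω : Fin (C + 1) → Y) c) ∂(chain κ next hnext C (next (x, y))) ∂(κ x)
        ≤ ∫ y, (f (x, y) + (a * (Φmax - Φ (next (x, y))) + C * b)) ∂(κ x) := by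
      refine integral_mono_ae ?_ ?_ (ae_of_all _ hinner)
      · have h := hint (C + 1) x
        rw [chain, Kernel.map_apply _ measurable_finCons] at h
        have h2 := (h.comp_measurable measurable_finCons).integral_compProd
        simpa only [Kernel.comap_apply, Function.comp_def] using h2
      · exact hfi.add ((((integrable_const _).sub hΦi).const_mul a).add (integrable_const _))
    have hi1 : Integrable (fun y => a * (Φmax - Φ (next (x, y)))) (κ x) :=
      ((integrable_const _).sub hΦi).const_mul a
    have hi2 : Integrable (fun y => a * (Φmax - Φ (next (x, y))) + C * b) (κ x) :=
      hi1.add (integrable_const _)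
    refine hmono.trans ?_
    rw [integral_add hfi hi2, integral_add hi1 (integrable_const _), integral_const_mul,
      integral_sub (integrable_const _) hΦi]
    have h := hstep x
    simp only [integral_const, probReal_univ, one_smul]
    push_cast
    linarith

end ChainPotential

/-! ### Expected progress of cycles and runs -/

section Run

variable {d : ℕ} {S A : Type*} [Fintype S] [MeasurableSpace S] [MeasurableSingletonClass S]
  [Fintype A] [MeasurableSpace A] [MeasurableSingletonClass A]
  (P : MDP S A) (π : PolicyFamily d S A) {n T K B m : ℕ} (est : Estimator d S A T)
  [IsMarkovKernel est] {Rstar Pistar Ls Astar γ ε η δ : ℝ}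

lemma cycleLaw_apply (n K : ℕ) (θ : Param d) : cycleLaw P π n K est θ
    = (Measure.pi fun _ : Fin n => sampleLaw P π est θ).prod (shuffleLaw K (n * T)) := by
  rw [cycleLaw, Kernel.prod_apply, Kernel.const_apply]
  rfl

lemma ae_cycleLaw_abs_le {θ : Param d}
    (hA : ∀ᵐ ω ∂(sampleLaw P π est θ), ∀ t, |ω.2 t| ≤ Astar) :
    ∀ᵐ D ∂(cycleLaw P π n K est θ), ∀ j t, |(D.1 j).2 t| ≤ Astar := by
  rw [cycleLaw_apply]
  have h : ∀ᵐ data ∂(Measure.pi fun _ : Fin n => sampleLaw P π est θ),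
      ∀ j t, |(data j).2 t| ≤ Astar :=
    ae_all_iff.2 fun j => 
      (Measure.tendsto_eval_ae_ae (μ := fun _ : Fin n => sampleLaw P π est θ)
        (i := j)).eventually hA
  exact Measure.quasiMeasurePreserving_fst.ae h

/-- By the policy gradient theorem the true gradient is within the estimation bias of the mean of
a bounded estimate, so the bound on the advantage estimates bounds the gradient as well. -/
lemma norm_gradient_objective_le
    (hR : ∀ s a, ∀ᵐ x ∂(P.step (s, a)), |x.1| ≤ Rstar)
    (hscore : ∀ θ s a, ‖π.score θ s a‖ ≤ Pistar) (hγ : 0 ≤ γ) (hγ1 : γ ≤ 1) (hδ : 0 ≤ δ)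
    (hP0 : 0 ≤ Pistar) (hA0 : 0 ≤ Astar) {θ : Param d}
    (hA : ∀ᵐ ω ∂(sampleLaw P π est θ), ∀ t, |ω.2 t| ≤ Astar)
    (hbias : ∀ t, estimatorBias P π γ est θ t ≤ δ ^ 2) :
    ‖gradient (objective P π T γ) θ‖ ≤ T * Pistar * Astar + T * Pistar * δ := by
  have h1 := norm_integral_rolloutGradient_sub_le P π est hR hscore hγ hγ1 hδ hA hbias
  have h2 := norm_integral_le_of_norm_le_const (f := rolloutGradient π γ θ)
    (hA.mono fun ω hω => norm_rolloutGradient_le π hscore hγ θ hω)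
  rw [probReal_univ, mul_one] at h2
  have h3 : ∑ t ∈ Finset.range T, γ ^ t ≤ T := by
    simpa using Finset.sum_le_card_nsmul (Finset.range T) (fun t => γ ^ t) 1
      fun t _ => pow_le_one₀ hγ hγ1
  have h4 : Pistar * Astar * ∑ t ∈ Finset.range T, γ ^ t ≤ Pistar * Astar * T :=
    mul_le_mul_of_nonneg_left h3 (mul_nonneg hP0 hA0)
  have h5 := norm_le_norm_add_norm_sub
    (∫ ω, rolloutGradient π γ θ ω ∂(sampleLaw P π est θ)) (gradient (objective P π T γ) θ)
  linarith

lemma integrable_of_bounded {Ω : Type*} [MeasurableSpace Ω] {q : Measure Ω} [IsProbabilityMeasure q]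
    {X : Ω → ℝ} (hX : Measurable X) {M : ℝ} (hM : ∀ ω, |X ω| ≤ M) : Integrable X q :=
  Integrable.of_bound hX.aestronglyMeasurable M (ae_of_all _ hM)

/-- The expected form of the progress bound of a cycle, given its initial parameter `θ`. -/
lemma integral_cycle_norm_gradient_sq_le
    (hR : ∀ s a, ∀ᵐ x ∂(P.step (s, a)), |x.1| ≤ Rstar)
    (hscore : ∀ θ s a, ‖π.score θ s a‖ ≤ Pistar)
    (hscoreLip : ∀ θ θ' s a, ‖π.score θ s a - π.score θ' s a‖ ≤ Ls * ‖θ - θ'‖)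
    (hγ : 0 ≤ γ) (hγ1 : γ ≤ 1) (hδ : 0 ≤ δ) (hP0 : 0 ≤ Pistar) (hA0 : 0 ≤ Astar)
    (hA : ∀ θ, ∀ᵐ ω ∂(sampleLaw P π est θ), ∀ t, |ω.2 t| ≤ Astar)
    (hbias : ∀ θ t, estimatorBias P π γ est θ t ≤ δ ^ 2)
    (hB : 0 < B) (hn : 0 < n) (hm : 0 < m) (hN : n * T = m * B) (hε : 0 < ε) (hη : 0 < η)
    {L : ℝ} (hL0 : 0 ≤ L) (hηL : L * (η * m) ≤ 1)
    (hL : ∀ θ θ', ‖gradient (objective P π T γ) θ - gradient (objective P π T γ) θ'‖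
      ≤ L * ‖θ - θ'‖)
    {ρ : ℝ} (hρ : ρ = η * K * m * (T * (1 + ε) * Pistar * Astar)) {V : ℝ}
    (hV : ∀ θ θold : Param d, ‖θ - θold‖ ≤ ρ → ∀ s a,
      (1 - π.prob θ s a / π.prob θold s a *
        if |π.prob θ s a / π.prob θold s a - 1| ≤ ε then (1 : ℝ) else 0) ^ 2 ≤ V)
    (θ : Param d) :
    ∫ D, ∑ e : Fin K, ‖gradient (objective P π T γ) (cycleParam π γ ε η B m D θ e.castSucc)‖ ^ 2
        ∂(cycleLaw P π n K est θ)
      ≤ 2 / (η * m) * (∫ D, objective P π T γ (cycleParam π γ ε η B m D θ (Fin.last K))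
          ∂(cycleLaw P π n K est θ) - objective P π T γ θ)
        + K * (3 * ((Pistar * Astar * ∑ t ∈ Finset.range T, γ ^ t) ^ 2 / n
            + (T * Pistar * δ) ^ 2)
          + 3 * (L * ρ) ^ 2 + 3 * (T * Astar * (|Ls| * ρ) + T * Astar * Pistar * √V) ^ 2) := by
  set J := objective P π T γ with hJdef
  have hJ : Differentiable ℝ J := fun θ => (hasGradientAt_objective P π hR T γ θ).differentiableAt
  have hgradL : LipschitzWith ⟨L, hL0⟩ (gradient J) :=
    LipschitzWith.of_dist_le_mul fun x y => by
      rw [dist_eq_norm, dist_eq_norm]; exact hL x y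
  have hG0 : 0 ≤ T * (1 + ε) * Pistar * Astar := by positivity
  have hρ0 : 0 ≤ ρ := by rw [hρ]; positivity
  have hM0 : 0 ≤ T * Astar * (|Ls| * ρ) + T * Astar * Pistar * √V := by positivity
  have hcyc : ∀ e, Measurable fun D : CycleData S A n T K => cycleParam π γ ε η B m D θ e :=
    fun e => (measurable_cycleParam π γ ε η B m e).comp measurable_prodMk_left
  set g : (Fin n → Sample S A T) → Param d :=
    fun data => (n : ℝ)⁻¹ • ∑ j, rolloutGradient π γ θ (data j) with hg
  have hgm : Measurable g := by
    have h := Finset.measurable_fun_sum Finset.univ fun j (_ : j ∈ Finset.univ) =>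
      (measurable_rolloutGradient π γ θ).comp
        (measurable_pi_apply (X := fun _ : Fin n => Sample S A T) j)
    exact h.const_smul ((n : ℝ)⁻¹)
  set bd := Pistar * Astar * ∑ t ∈ Finset.range T, γ ^ t with hbd
  have hbd0 : 0 ≤ bd := mul_nonneg (mul_nonneg hP0 hA0)
    (Finset.sum_nonneg fun _ _ => pow_nonneg hγ _)
  have hbound : ∀ᵐ D ∂(cycleLaw P π n K est θ), ‖g D.1 - gradient J θ‖ ≤ bd + ‖gradient J θ‖ := by
    filter_upwards [ae_cycleLaw_abs_le P π est (n := n) (K := K) (hA θ)] with D hD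
    refine (norm_sub_le _ _).trans (add_le_add ?_ le_rfl)
    exact norm_inv_smul_sum_le hn (by simp) hbd0 fun j _ =>
      norm_rolloutGradient_le π hscore hγ θ (hD j)
  have hgi : Integrable (fun D => ‖g D.1 - gradient J θ‖ ^ 2) (cycleLaw P π n K est θ) := by
    refine Integrable.of_bound (((hgm.comp measurable_fst).sub_const _).norm.pow_const
      2).aestronglyMeasurable ((bd + ‖gradient J θ‖) ^ 2) (hbound.mono fun D hD => ?_)
    rw [Real.norm_of_nonneg (sq_nonneg _)]
    exact pow_le_pow_left₀ (norm_nonneg _) hD 2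
  have hJi : Integrable (fun D => J (cycleParam π γ ε η B m D θ (Fin.last K)))
      (cycleLaw P π n K est θ) :=
    integrable_of_bounded (hJ.continuous.measurable.comp (hcyc _))
      fun D => abs_objective_le P π hR T hγ _
  have hgradi : ∀ e : Fin K, Integrable
      (fun D => ‖gradient J (cycleParam π γ ε η B m D θ e.castSucc)‖ ^ 2)
      (cycleLaw P π n K est θ) := fun e =>
    integrable_of_bounded (M := (T * Pistar * Astar + T * Pistar * δ) ^ 2)
      ((hgradL.continuous.measurable.comp (hcyc _)).norm.pow_const 2) fun D => by
        rw [abs_of_nonneg (sq_nonneg _)]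
        exact pow_le_pow_left₀ (norm_nonneg _) (norm_gradient_objective_le P π est hR hscore hγ hγ1
          hδ hP0 hA0 (hA _) (hbias _)) 2
  have hpath : ∀ᵐ D ∂(cycleLaw P π n K est θ),
      ∑ e : Fin K, ‖gradient J (cycleParam π γ ε η B m D θ e.castSucc)‖ ^ 2
      ≤ 2 / (η * m) * (J (cycleParam π γ ε η B m D θ (Fin.last K)) - J θ)
        + K * (3 * ‖g D.1 - gradient J θ‖ ^ 2 + 3 * (L * ρ) ^ 2
          + 3 * (T * Astar * (|Ls| * ρ) + T * Astar * Pistar * √V) ^ 2) := by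
    filter_upwards [ae_cycleLaw_abs_le P π est (n := n) (K := K) (hA θ)] with D hD
    rw [hρ]
    refine sum_norm_gradient_sq_le π hJ hL0 hL hB hn hm hN hε.le hη hηL hG0
      (fun θ' i => norm_clippedContribution_le π hscore hγ hγ1 hε.le T θ' θ _ _ _ (hD _ _))
      (by rw [← hρ]; exact hM0) fun θ' hθ' i => ?_
    rw [← hρ] at hθ' ⊢
    refine (norm_clippedContribution_sub_self_le π hscore hscoreLip hγ hγ1 hε.le T θ' θ _ _ _
      (hD _ _) (hV θ' θ hθ' _ _)).trans (add_le_add ?_ le_rfl)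
    refine mul_le_mul_of_nonneg_left ?_ (by positivity)
    exact mul_le_mul (le_abs_self Ls) hθ' (norm_nonneg _) (abs_nonneg _)
  have hi1 : Integrable (fun D => 2 / (η * m) *
      (J (cycleParam π γ ε η B m D θ (Fin.last K)) - J θ)) (cycleLaw P π n K est θ) :=
    (hJi.sub (integrable_const _)).const_mul _
  have hi2 : Integrable (fun D => 3 * ‖g D.1 - gradient J θ‖ ^ 2) (cycleLaw P π n K est θ) :=
    hgi.const_mul 3
  generalize 3 * (L * ρ) ^ 2 = a₁ at hpath ⊢
  generalize 3 * (T * Astar * (|Ls| * ρ) + T * Astar * Pistar * √V) ^ 2 = a₂ at hpath ⊢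
  have hi3 : Integrable (fun D => 3 * ‖g D.1 - gradient J θ‖ ^ 2 + a₁) (cycleLaw P π n K est θ) :=
    hi2.add (integrable_const _)
  have hi4 : Integrable (fun D => K * (3 * ‖g D.1 - gradient J θ‖ ^ 2 + a₁ + a₂))
      (cycleLaw P π n K est θ) := (hi3.add (integrable_const _)).const_mul _
  have hmono := integral_mono_ae (integrable_finsetSum _ fun e _ => hgradi e)
    (hi1.add hi4) hpath
  refine hmono.trans ?_
  simp only [Pi.add_apply]
  rw [integral_add hi1 hi4, integral_const_mul, integral_const_mul,
    integral_add hi3 (integrable_const _), integral_add hi2 (integrable_const _),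
    integral_sub hJi (integrable_const _), integral_const_mul]
  simp only [integral_const, probReal_univ, one_smul]
  have hfst : ∫ D, ‖g D.1 - gradient J θ‖ ^ 2 ∂(cycleLaw P π n K est θ)
      ≤ bd ^ 2 / n + (T * Pistar * δ) ^ 2 := by
    rw [cycleLaw_apply, integral_fun_fst (fun data => ‖g data - gradient J θ‖ ^ 2), probReal_univ,
      one_smul]
    refine (integral_norm_sq_average_sub_le _ hn (measurable_rolloutGradient π γ θ)
      ((hA θ).mono fun ω hω => norm_rolloutGradient_le π hscore hγ θ hω) _).trans ?_
    gcongr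
    exact norm_integral_rolloutGradient_sub_le P π est hR hscore hγ hγ1 hδ (hA θ) (hbias θ)
  gcongr

lemma iterate_zero_eq {C : ℕ} (θ₀ : Param d) (ω : Fin C → CycleData S A n T K) (c : Fin C)
    (e : Fin K) : iterate π γ ε η B m θ₀ ω c e 0 = cycleParam π γ ε η B m (ω c)
      (chainState (fun z : Param d × CycleData S A n T K =>
        cycleParam π γ ε η B m z.2 z.1 (Fin.last K)) θ₀ ω c.castSucc) e.castSucc := by
  rw [iterate, epochParam]
  rfl

lemma integrable_norm_gradient_sq_iterate {J : Param d → ℝ}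
    (hgrad : Continuous (gradient J)) {M : ℝ} (hM : ∀ θ, ‖gradient J θ‖ ≤ M) {C : ℕ}
    (θ₀ : Param d) (c : Fin C) (e : Fin K) :
    Integrable (fun ω => ‖gradient J (iterate π γ ε η B m θ₀ ω c e 0)‖ ^ 2)
      (runLaw π P n K C γ ε η B m est θ₀) := by
  have hnext : Measurable fun z : Param d × CycleData S A n T K =>
    cycleParam π γ ε η B m z.2 z.1 (Fin.last K) := measurable_cycleParam π γ ε η B m (Fin.last K)
  have : IsProbabilityMeasure (runLaw π P n K C γ ε η B m est θ₀) := by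
    unfold runLaw; infer_instance
  have hpair : Measurable fun ω : Fin C → CycleData S A n T K =>
      (chainState (fun z : Param d × CycleData S A n T K =>
        cycleParam π γ ε η B m z.2 z.1 (Fin.last K)) θ₀ ω c.castSucc, ω c) :=
    (measurable_chainState hnext θ₀ c.castSucc).prodMk (measurable_pi_apply c)
  have hmeas := (((hgrad.measurable.comp
    (measurable_cycleParam π γ ε η B m e.castSucc)).norm.pow_const 2).comp hpair)
  simp only [Function.comp_def, ← iterate_zero_eq] at hmeas
  refine integrable_of_bounded hmeas (M := M ^ 2) fun ω => ?_
  rw [abs_of_nonneg (sq_nonneg _)]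
  exact pow_le_pow_left₀ (norm_nonneg _) (hM _) 2

/-- Summing the progress of the cycles over a run. -/
lemma integral_run_norm_gradient_sq_le
    (hR : ∀ s a, ∀ᵐ x ∂(P.step (s, a)), |x.1| ≤ Rstar) (hγ : 0 ≤ γ) (hη : 0 ≤ η)
    (hgrad : Continuous (gradient (objective P π T γ))) {M b : ℝ}
    (hM : ∀ θ, ‖gradient (objective P π T γ) θ‖ ≤ M)
    (hcycle : ∀ θ, ∫ D, ∑ e : Fin K,
        ‖gradient (objective P π T γ) (cycleParam π γ ε η B m D θ e.castSucc)‖ ^ 2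
        ∂(cycleLaw P π n K est θ)
      ≤ 2 / (η * m) * (∫ D, objective P π T γ (cycleParam π γ ε η B m D θ (Fin.last K))
          ∂(cycleLaw P π n K est θ) - objective P π T γ θ) + b) (C : ℕ) (θ₀ : Param d) :
    ∑ c : Fin C, ∑ e : Fin K, ∫ ω, ‖gradient (objective P π T γ)
        (iterate π γ ε η B m θ₀ ω c e 0)‖ ^ 2 ∂(runLaw π P n K C γ ε η B m est θ₀)
      ≤ 2 / (η * m) * ((⨆ θ, objective P π T γ θ) - objective P π T γ θ₀) + C * b := by
  set J := objective P π T γ with hJdef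
  set next : Param d × CycleData S A n T K → Param d :=
    fun z => cycleParam π γ ε η B m z.2 z.1 (Fin.last K) with hnextdef
  have hnext : Measurable next := measurable_cycleParam π γ ε η B m (Fin.last K)
  have hlaw : runLaw π P n K C γ ε η B m est θ₀
    = chain (cycleLaw P π n K est) next hnext C θ₀ := rfl
  have hint := integrable_norm_gradient_sq_iterate (m := m) (B := B) (ε := ε) (η := η) (γ := γ) P π
    (n := n) (K := K) est hgrad hM (C := C) θ₀
  simp only [iterate_zero_eq] at hint ⊢
  have hJ : Differentiable ℝ J := fun θ => (hasGradientAt_objective P π hR T γ θ).differentiableAt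
  have hbdd : BddAbove (Set.range J) :=
    ⟨_, Set.forall_mem_range.2 fun θ => (abs_le.1 (abs_objective_le P π hR T hγ θ)).2⟩
  have hM2 : ∀ θ, ‖gradient J θ‖ ^ 2 ≤ M ^ 2 := fun θ => pow_le_pow_left₀ (norm_nonneg _) (hM θ) 2
  have hfe : ∀ e : Fin K, Measurable fun z : Param d × CycleData S A n T K =>
      ‖gradient J (cycleParam π γ ε η B m z.2 z.1 e.castSucc)‖ ^ 2 := fun e =>
    (hgrad.measurable.comp (measurable_cycleParam π γ ε η B m e.castSucc)).norm.pow_const 2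
  have h := integral_chain_sum_le (κ := cycleLaw P π n K est) hnext
    (f := fun z => ∑ e : Fin K, ‖gradient J (cycleParam π γ ε η B m z.2 z.1 e.castSucc)‖ ^ 2)
    (Finset.measurable_fun_sum _ fun e _ => hfe e) (M := K * M ^ 2) (fun z => by
      rw [abs_of_nonneg (Finset.sum_nonneg fun e _ => sq_nonneg _)]
      refine (Finset.sum_le_sum fun e _ => hM2 _).trans ?_
      simp) hJ.continuous.measurable (fun θ => abs_objective_le P π hR T hγ θ)
    (fun θ => le_ciSup hbdd θ) (by positivity) hcycle C θ₀
  rw [← hlaw, integral_finsetSum _ fun c _ => integrable_finsetSum _ fun e _ => hint c e] at h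
  simp only [integral_finsetSum _ fun e _ => hint _ e] at h
  exact h

lemma mul_ciInf_le_sum {C K : ℕ} (F : Fin C → Fin K → ℝ) :
    (C * K : ℝ) * ⨅ ce : Fin C × Fin K, F ce.1 ce.2 ≤ ∑ c, ∑ e, F c e := by
  rw [← Fintype.sum_prod_type' F]
  have h := Finset.card_nsmul_le_sum Finset.univ (fun ce : Fin C × Fin K => F ce.1 ce.2)
    (⨅ ce : Fin C × Fin K, F ce.1 ce.2) fun ce _ => ciInf_le (Set.finite_range _).bddBelow ce
  simpa using h

/-- The best iterate of a run is at least as good as the average iterate. -/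
lemma ciInf_integral_norm_gradient_sq_le {C : ℕ} (hC : 0 < C) (hK : 0 < K) (hm : 0 < m)
    (hR : ∀ s a, ∀ᵐ x ∂(P.step (s, a)), |x.1| ≤ Rstar) (hγ : 0 ≤ γ) (hη : 0 < η)
    (hgrad : Continuous (gradient (objective P π T γ))) {M b : ℝ}
    (hM : ∀ θ, ‖gradient (objective P π T γ) θ‖ ≤ M)
    (hcycle : ∀ θ, ∫ D, ∑ e : Fin K,
        ‖gradient (objective P π T γ) (cycleParam π γ ε η B m D θ e.castSucc)‖ ^ 2
        ∂(cycleLaw P π n K est θ)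
      ≤ 2 / (η * m) * (∫ D, objective P π T γ (cycleParam π γ ε η B m D θ (Fin.last K))
          ∂(cycleLaw P π n K est θ) - objective P π T γ θ) + K * b) (θ₀ : Param d) :
    ⨅ ce : Fin C × Fin K, ∫ ω, ‖gradient (objective P π T γ)
        (iterate π γ ε η B m θ₀ ω ce.1 ce.2 0)‖ ^ 2 ∂(runLaw π P n K C γ ε η B m est θ₀)
      ≤ 2 * ((⨆ θ, objective P π T γ θ) - objective P π T γ θ₀) / (η * C * K * m) + b := by
  have hm' : (0 : ℝ) < m := by exact_mod_cast hm
  have hC' : (0 : ℝ) < C := by exact_mod_cast hC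
  have hK' : (0 : ℝ) < K := by exact_mod_cast hK
  have hinf := (mul_ciInf_le_sum _).trans
    (integral_run_norm_gradient_sq_le P π est hR hγ hη.le hgrad hM hcycle C θ₀)
  refine le_of_mul_le_mul_left (hinf.trans (le_of_eq ?_)) (mul_pos hC' hK')
  field_simp

lemma ciInf_integral_norm_gradient_sq_le_of_norm_le {C : ℕ} (hC : 0 < C) (hK : 0 < K)
    {J : Param d → ℝ} (hgrad : Continuous (gradient J)) {M : ℝ}
    (hM : ∀ θ, ‖gradient J θ‖ ≤ M) (θ₀ : Param d) :
    ⨅ ce : Fin C × Fin K, ∫ ω, ‖gradient J (iterate π γ ε η B m θ₀ ω ce.1 ce.2 0)‖ ^ 2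
      ∂(runLaw π P n K C γ ε η B m est θ₀) ≤ M ^ 2 := by
  have : IsProbabilityMeasure (runLaw π P n K C γ ε η B m est θ₀) := by
    unfold runLaw; infer_instance
  refine (ciInf_le (Set.finite_range _).bddBelow
    ((⟨0, hC⟩, ⟨0, hK⟩) : Fin C × Fin K)).trans ?_
  have h := integral_mono
    (integrable_norm_gradient_sq_iterate (m := m) (B := B) (ε := ε) (η := η) (γ := γ) P π
      (n := n) (K := K) est hgrad hM (C := C) θ₀ ⟨0, hC⟩ ⟨0, hK⟩) (integrable_const (M ^ 2))
    fun ω => pow_le_pow_left₀ (norm_nonneg _) (hM _) 2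
  simpa only [integral_const, probReal_univ, one_smul] using h

end Run

/-! ### The terms of the bound -/

section Constants

lemma ratio_term_eq {η ε a b k m G B p : ℝ} (hη : 0 ≤ η) (ha : 0 ≤ a) (hb : 0 ≤ b)
    (hk : 0 ≤ k) (hm : 0 ≤ m) (hG : 0 ≤ G) :
    42 * η ^ (2 * p) * B ^ 2 * ε ^ (2 * (1 - p)) * a ^ (2 * p) * b ^ (2 * p) * k ^ (2 * p)
        * m ^ (2 * p) * G ^ (2 * p)
      = 42 * B ^ 2 * (ε ^ (2 * (1 - p)) * (a * (b * (η * k * m * G))) ^ (2 * p)) := by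
  rw [Real.mul_rpow ha (by positivity), Real.mul_rpow hb (by positivity),
    Real.mul_rpow (by positivity) hG, Real.mul_rpow (by positivity) hm, Real.mul_rpow hη hk]
  ring

lemma clip_term_eq {η ε a b k m G B q : ℝ} (hη : 0 ≤ η) (hε : 0 ≤ ε) (ha : 0 ≤ a) (hb : 0 ≤ b)
    (hk : 0 ≤ k) (hm : 0 ≤ m) (hG : 0 ≤ G) :
    42 * η ^ q * B ^ 2 * a ^ q * b ^ q * k ^ q * m ^ q * G ^ q / ε ^ q
      = 42 * B ^ 2 * (a * (b * (η * k * m * G)) / ε) ^ q := by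
  rw [Real.div_rpow (by positivity) hε, Real.mul_rpow ha (by positivity),
    Real.mul_rpow hb (by positivity), Real.mul_rpow (by positivity) hG,
    Real.mul_rpow (by positivity) hm, Real.mul_rpow hη hk]
  ring

/-- Outside the range of the local estimates one of the two clipping terms is at least `1`. -/
lemma one_le_ratio_term_add_clip_term {ε x p q : ℝ} (hε : 0 < ε) (hx : 1 ≤ x) (hp0 : 0 < p)
    (hp1 : p < 1) (hq0 : 0 < q) :
    1 ≤ ε ^ (2 * (1 - p)) * x ^ (2 * p) + (x / ε) ^ q := by
  rcases le_total ε 1 with h | h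
  · have h1 : 1 ≤ (x / ε) ^ q :=
      Real.one_le_rpow ((one_le_div hε).2 (h.trans hx)) hq0.le
    have h2 : 0 ≤ ε ^ (2 * (1 - p)) * x ^ (2 * p) := by positivity
    linarith
  · have h1 : 1 ≤ ε ^ (2 * (1 - p)) := Real.one_le_rpow h (by linarith)
    have h2 : 1 ≤ x ^ (2 * p) := Real.one_le_rpow hx (by linarith)
    have h3 : 0 ≤ (x / ε) ^ q := by positivity
    nlinarith

lemma ratio_term_add_clip_term_mono {ε w x p q : ℝ} (hε : 0 < ε) (hw : 0 ≤ w) (hwx : w ≤ x)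
    (hp0 : 0 < p) (hq0 : 0 < q) :
    ε ^ (2 * (1 - p)) * w ^ (2 * p) + (w / ε) ^ q
      ≤ ε ^ (2 * (1 - p)) * x ^ (2 * p) + (x / ε) ^ q := by
  gcongr

lemma add_error_le_local {F bd u l x y b V X Y : ℝ} (hbd : 0 ≤ bd) (hV : V ≤ 7 * (X + Y))
    (hy : y ^ 2 = b ^ 2 * V) :
    F + (3 * (bd + u ^ 2) + 3 * l ^ 2 + 3 * (x + y) ^ 2)
      ≤ F + (42 * x ^ 2 + 6 * l ^ 2) + 42 * b ^ 2 * X + 42 * b ^ 2 * Y + 12 * bd + 12 * u ^ 2 := by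
  have h1 := add_sq_le (a := x) (b := y)
  have h2 := mul_le_mul_of_nonneg_left hV (sq_nonneg b)
  linarith [sq_nonneg x, sq_nonneg l, sq_nonneg u]

lemma sq_add_le_of_one_le {F bd u l x b X Y : ℝ} (hF : 0 ≤ F) (hbd : 0 ≤ bd) (h : 1 ≤ X + Y) :
    (b + u) ^ 2
      ≤ F + (42 * x ^ 2 + 6 * l ^ 2) + 42 * b ^ 2 * X + 42 * b ^ 2 * Y + 12 * bd + 12 * u ^ 2 := by
  have h1 := add_sq_le (a := b) (b := u)
  have h2 := mul_le_mul_of_nonneg_left h (sq_nonneg b)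
  linarith [sq_nonneg x, sq_nonneg l, sq_nonneg u, sq_nonneg b]

end Constants

end PPO

theorem mainTheorem4 {d : ℕ} {S A : Type*}
    [Fintype S] [MeasurableSpace S] [MeasurableSingletonClass S]
    [Fintype A] [MeasurableSpace A] [MeasurableSingletonClass A]
    (P : PPO.MDP S A) (π : PPO.PolicyFamily d S A)
    (T n B m K C : ℕ) (hT : 0 < T) (hn : 0 < n) (hB : 0 < B) (hNB : n * T = m * B)
    (hK : 0 < K) (hC : 0 < C)
    (γ ε η : ℝ) (hγ0 : 0 ≤ γ) (hγ1 : γ ≤ 1) (hε : 0 < ε) (hη : 0 < η)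
    (est : PPO.Estimator d S A T) [IsMarkovKernel est] (θ₀ : PPO.Param d)
    (Rstar Pistar Ls Astar δ : ℝ)
    (hR : ∀ s a, ∀ᵐ x ∂(P.step (s, a)), |x.1| ≤ Rstar)
    (hscore : ∀ θ s a, ‖π.score θ s a‖ ≤ Pistar)
    (hscoreLip : ∀ θ θ' s a, ‖π.score θ s a - π.score θ' s a‖ ≤ Ls * ‖θ - θ'‖)
    (hδ : 0 ≤ δ)
    (hAbdd : ∀ θ, ∀ᵐ ω ∂(PPO.sampleLaw P π est θ), ∀ t, |ω.2 t| ≤ Astar)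
    (hAbias : ∀ θ t, PPO.estimatorBias P π γ est θ t ≤ δ ^ 2) :
    -- `J` is differentiable with Lipschitz gradient and bounded from above
    (Differentiable ℝ (PPO.objective P π T γ) ∧
      (∀ θ θ', ‖gradient (PPO.objective P π T γ) θ - gradient (PPO.objective P π T γ) θ'‖
        ≤ PPO.smoothnessConst T γ Rstar Pistar Ls * ‖θ - θ'‖) ∧
      BddAbove (Set.range (PPO.objective P π T γ))) ∧
    -- the convergence bound, for every Lipschitz constant `L` of the gradient
    ∀ L : ℝ, 0 < L →
      (∀ θ θ', ‖gradient (PPO.objective P π T γ) θ - gradient (PPO.objective P π T γ) θ'‖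
        ≤ L * ‖θ - θ'‖) →
      η < 1 / (L * m) →
      ∀ p q : ℝ, 0 < p → p < 1 → 0 < q → q < 1 →
        let J := PPO.objective P π T γ
        let Δ₀ := (⨆ θ, J θ) - J θ₀
        let N : ℝ := n * T
        let B₁ := T * Astar * Ls
        let B₂ := T * Astar * Pistar
        let B₃ := T * Astar * Pistar
        let G := T * (1 + ε) * Pistar * Astar
        let σsq := T * Pistar ^ 2 * Astar ^ 2 * (∑ t ∈ Finset.range T, γ ^ t) ^ 2
        let cardA : ℝ := Fintype.card A
        (∀ (c : Fin C) (e : Fin K), Integrable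
          (fun ω => ‖gradient J (PPO.iterate π γ ε η B m θ₀ ω c e 0)‖ ^ 2)
          (PPO.runLaw π P n K C γ ε η B m est θ₀)) ∧
        (⨅ ce : Fin C × Fin K,
          ∫ ω, ‖gradient J (PPO.iterate π γ ε η B m θ₀ ω ce.1 ce.2 0)‖ ^ 2
            ∂(PPO.runLaw π P n K C γ ε η B m est θ₀)) ≤
          2 * Δ₀ / (η * C * K * m)
          + 6 * η ^ 2 * (7 * B₁ ^ 2 + L ^ 2) * K ^ 2 * m ^ 2 * G ^ 2
          + 42 * η ^ (2 * p) * B₂ ^ 2 * ε ^ (2 * (1 - p)) * cardA ^ (2 * p)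
              * Pistar ^ (2 * p) * (K : ℝ) ^ (2 * p) * (m : ℝ) ^ (2 * p) * G ^ (2 * p)
          + 42 * η ^ q * B₃ ^ 2 * cardA ^ q * Pistar ^ q * (K : ℝ) ^ q * (m : ℝ) ^ q * G ^ q
              / ε ^ q
          + 12 * σsq / N
          + 12 * T ^ 2 * Pistar ^ 2 * δ ^ 2 := by
  open PPO in
  obtain ⟨s₀⟩ := nonempty_state P
  obtain ⟨a₀⟩ := π.nonempty_action s₀
  have hbdd : BddAbove (Set.range (objective P π T γ)) :=
    ⟨_, Set.forall_mem_range.2 fun θ => (abs_le.1 (abs_objective_le P π hR T hγ0 θ)).2⟩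
  refine ⟨⟨fun θ => (hasGradientAt_objective P π hR T γ θ).differentiableAt,
    norm_gradient_objective_sub_le P π hR T hγ0 hscore hscoreLip, hbdd⟩, ?_⟩
  intro L hL0 hL hηL p q hp0 hp1 hq0 hq1 J Δ₀ N B₁ B₂ B₃ G σsq cardA
  have hP0 : 0 ≤ Pistar := (norm_nonneg _).trans (hscore θ₀ s₀ a₀)
  have hA0 : 0 ≤ Astar := by
    obtain ⟨ω, hω⟩ := (hAbdd θ₀).exists
    exact (abs_nonneg _).trans (hω ⟨0, hT⟩)
  have hm : 0 < m := Nat.pos_of_ne_zero fun h => by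
    have := Nat.mul_pos hn hT
    simp [hNB, h] at this
  have hm' : (0 : ℝ) < m := by exact_mod_cast hm
  have hC' : (0 : ℝ) < C := by exact_mod_cast hC
  have hK' : (0 : ℝ) < K := by exact_mod_cast hK
  have hn' : (0 : ℝ) < n := by exact_mod_cast hn
  have hT' : (0 : ℝ) < T := by exact_mod_cast hT
  have hG0 : 0 ≤ G := by positivity
  have hgrad : Continuous (gradient J) :=
    (LipschitzWith.of_dist_le_mul (K := ⟨L, hL0.le⟩) fun x y => by
      rw [dist_eq_norm, dist_eq_norm]; exact hL x y).continuous
  have hM : ∀ θ, ‖gradient J θ‖ ≤ T * Pistar * Astar + T * Pistar * δ := fun θ =>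
    norm_gradient_objective_le P π est hR hscore hγ0 hγ1 hδ hP0 hA0 (hAbdd θ) (hAbias θ)
  have hint := integrable_norm_gradient_sq_iterate (m := m) (B := B) (ε := ε) (η := η) (γ := γ) P π
    (n := n) (K := K) est hgrad hM (C := C) θ₀
  refine ⟨hint, ?_⟩
  have hcard : 1 ≤ cardA := by
    have : Nonempty A := ⟨a₀⟩
    exact Nat.one_le_cast.2 (Fintype.card_pos (α := A))
  have hΔ0 : 0 ≤ Δ₀ := sub_nonneg.2 (le_ciSup hbdd θ₀)
  rw [ratio_term_eq hη.le (zero_le_one.trans hcard) hP0 hK'.le hm'.le hG0,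
    clip_term_eq hη.le hε.le (zero_le_one.trans hcard) hP0 hK'.le hm'.le hG0]
  set ρ := η * K * m * G with hρ
  have hρ0 : 0 ≤ ρ := by positivity
  set w := Pistar * ρ with hw
  have hw0 : 0 ≤ w := mul_nonneg hP0 hρ0
  have hwx : w ≤ cardA * w := le_mul_of_one_le_left hw0 hcard
  have hB2 : B₂ = T * Pistar * Astar := by simp only [B₂]; ring
  have hB3 : B₃ = B₂ := rfl
  have hdrift : 6 * η ^ 2 * (7 * B₁ ^ 2 + L ^ 2) * K ^ 2 * m ^ 2 * G ^ 2
      = 42 * (B₁ * ρ) ^ 2 + 6 * (L * ρ) ^ 2 := by rw [hρ]; ring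
  have hσ : 12 * σsq / N = 12 * ((Pistar * Astar * ∑ t ∈ Finset.range T, γ ^ t) ^ 2 / n) := by
    simp only [σsq, N]
    field_simp
  have hδ2 : 12 * T ^ 2 * Pistar ^ 2 * δ ^ 2 = 12 * (T * Pistar * δ) ^ 2 := by ring
  rw [hdrift, hσ, hδ2, hB3]
  set bd := (Pistar * Astar * ∑ t ∈ Finset.range T, γ ^ t) ^ 2 / n with hbd
  have hbd0 : 0 ≤ bd := by positivity
  have hfirst : 0 ≤ 2 * Δ₀ / (η * C * K * m) := by positivity
  rcases le_total w 1 with hw1 | hw1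
  · set V := 7 * (ε ^ (2 * (1 - p)) * w ^ (2 * p) + (w / ε) ^ q) with hVdef
    have hV0 : 0 ≤ V := by positivity
    have hηL' : L * (η * m) ≤ 1 := by
      rw [lt_div_iff₀ (by positivity)] at hηL
      linarith
    have hcycle := integral_cycle_norm_gradient_sq_le P π est (K := K) hR hscore hscoreLip hγ0 hγ1
      hδ hP0 hA0 hAbdd hAbias hB hn hm hNB hε hη hL0.le hηL' hL hρ (V := V)
      fun θ θold h s a => sq_one_sub_clipped_ratio_le π hscore hε hw0 hw1
        (mul_le_mul_of_nonneg_left h hP0) s a hp0 hp1 hq0 hq1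
    have havg := ciInf_integral_norm_gradient_sq_le P π est hC hK hm hR hγ0 hη hgrad hM hcycle θ₀
    refine havg.trans ?_
    have hx : (B₁ * ρ) ^ 2 = (T * Astar * (|Ls| * ρ)) ^ 2 := by
      simp only [B₁, mul_pow, sq_abs]
      ring
    rw [hx]
    refine add_error_le_local (V := V) hbd0 ?_ ?_
    · exact mul_le_mul_of_nonneg_left
        (ratio_term_add_clip_term_mono hε hw0 hwx hp0 hq0) (by norm_num)
    · rw [mul_pow, Real.sq_sqrt hV0]
  · -- Here the likelihood ratio is not controlled, but one of the clipping terms is at least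
    -- `42 B₂²`, and together with the bias term this exceeds the squared norm of any gradient.
    refine (ciInf_integral_norm_gradient_sq_le_of_norm_le P π est hC hK hgrad hM θ₀).trans ?_
    rw [← hB2]
    exact sq_add_le_of_one_le hfirst hbd0
      (one_le_ratio_term_add_clip_term hε (hw1.trans hwx) hp0 hp1 hq0)
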